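/- Fix $q\in\mathbf{C}$ with $|q|>1$ and $z_0\in\mathbf{C}^*$. Let $\mathcal{R}=\mathrm{Rep}_{\mathbf{C}}(\mathbf{Z})$ be the category whose objects are the pairs $(\mathbf{C}^n,A)$ with $n\ge 0$, $A\in GL_n(\mathbf{C})$, and whose morphisms $(\mathbf{C}^n,A)\to(\mathbf{C}^p,B)$ are the matrices $F\in M_{p,n}(\mathbf{C})$ with $FA=BF$; let $\mathcal{P}^{(0)}$ be the category with the same objects, whose morphisms are the matrices $F\in M_{p,n}(\mathbf{C}(\{z\}))$ with $F(qz)A=BF(z)$, where $\mathbf{C}(\{z\})$ is the field of convergent Laurent series (germs at $0$ of meromorphic functions). Both are tensor categories under $(\mathbf{C}^n,A)\otimes(\mathbf{C}^m,B)=(\mathbf{C}^{nm},A\otimes B)$, $F\otimes G$ the Kronecker product, with unit $(\mathbf{C},1)$. Morphisms of $\mathcal{P}^{(0)}$ are Laurent polynomials in $z$, so that they can be evaluated at $z_0$. Let $\omega$ be the forgetful tensor functor $(\mathbf{C}^n,A)\mapsto\mathbf{C}^n$, $F\mapsto F$ on $\mathcal{R}$ and $\omega^{(0)}_{z_0}$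 the tensor functor $(\mathbf{C}^n,A)\mapsto\mathbf{C}^n$, $F\mapsto F(z_0)$ on $\mathcal{P}^{(0)}$, both with values in finite-dimensional complex vector spaces, and let $\mathrm{Aut}^\otimes$ denote the group of tensor automorphisms. Since $\omega^{(0)}_{z_0}$ restricts to $\omega$ along the embedding $\mathcal{R}\to\mathcal{P}^{(0)}$, there is a restriction homomorphism $\rho:\mathrm{Aut}^\otimes(\omega^{(0)}_{z_0})\to\mathrm{Aut}^\otimes(\omega)$. Put $\mathbf{Z}^{alg}=\mathrm{Hom}_{grp}(\mathbf{C}^*,\mathbf{C}^*)\times\mathbf{C}$. For $A\in GL_n(\mathbf{C})$ with multiplicative Dunford decomposition $A=A_sA_u$ ($A_s=Q\,\mathrm{diag}(c_1,\dots,c_n)\,Q^{-1}$ semisimple, $A_u$ unipotent, $A_sA_u=A_uA_s$) and $(\gamma,\lambda)\in\mathbf{Z}^{alg}$, put $A^{(\gamma,\lambda)}=\gamma(A_s)A_u^{\lambda}$, where $\gamma(A_s)=Q\,\mathrm{diag}(\gamma(c_1),\dots,\gamma(c_n))\,Q^{-1}$ and $A_u^\lambda=\sum_{k\ge0}\binom{\lambda}{k}(A_u-I_n)^k$.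 Then $A^{(\gamma,\lambda)}$ is well defined, and $(\gamma,\lambda)\mapsto\big((\mathbf{C}^n,A)\mapsto A^{(\gamma,\lambda)}\big)$ is an isomorphism of groups $\mathbf{Z}^{alg}\to\mathrm{Aut}^\otimes(\omega)$; the restriction $\rho$ is injective; and, under this identification, its image is $$\mathrm{Aut}^\otimes(\omega^{(0)}_{z_0})=\{(\gamma,\lambda)\in\mathrm{Hom}_{grp}(\mathbf{C}^*,\mathbf{C}^*)\times\mathbf{C} : \gamma(q)=1\}.$$ Equivalently, there is an isomorphism of groups $\mathrm{Hom}_{grp}(\mathbf{C}^*/q^{\mathbf{Z}},\mathbf{C}^*)\times\mathbf{C}\to\mathrm{Aut}^\otimes(\omega^{(0)}_{z_0})$ which, composed with $\rho$, sends $(\chi,\lambda)$ to the element $(\chi\circ\pi,\lambda)$ of $\mathbf{Z}^{alg}$, where $\pi:\mathbf{C}^*\to\mathbf{C}^*/q^{\mathbf{Z}}$ is the projection. -/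

import Mathlib

open CategoryTheory MonoidalCategory

noncomputable section

namespace QDiff

/-- The bijection `(i₁, i₂) ↦ i₁ + n₁ i₂` (indices starting at `0`) that identifies
`K^{n₁} ⊗ K^{n₂}` with `K^{n₁ n₂}`. -/
def pairEquiv (n₁ n₂ : ℕ) : Fin n₁ × Fin n₂ ≃ Fin (n₁ * n₂) :=
  ((Equiv.prodComm _ _).trans finProdFinEquiv).trans (finCongr (Nat.mul_comm n₂ n₁))

/-- The Kronecker product of matrices, with rows and columns numbered through `pairEquiv`. -/
def kron {R : Type} [CommRing R] {p₁ n₁ p₂ n₂ : ℕ} (F : Matrix (Fin p₁) (Fin n₁) R)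
    (G : Matrix (Fin p₂) (Fin n₂) R) : Matrix (Fin (p₁ * p₂)) (Fin (n₁ * n₂)) R :=
  (Matrix.kronecker F G).submatrix (pairEquiv p₁ p₂).symm (pairEquiv n₁ n₂).symm

/-- The matrix of the linear map that sends the basis vector `j` to the basis vector `s j`. -/
def permMat (R : Type) [CommRing R] {n m : ℕ} (s : Fin n ≃ Fin m) :
    Matrix (Fin m) (Fin n) R :=
  (1 : Matrix (Fin m) (Fin m) R).submatrix id s

/-- The bijection of indices underlying `(X ⊗ Y) ⊗ Z ≅ X ⊗ (Y ⊗ Z)`. -/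
def assocEquiv (a b c : ℕ) : Fin (a * b * c) ≃ Fin (a * (b * c)) :=
  (pairEquiv (a * b) c).symm.trans
    ((((pairEquiv a b).symm.prodCongr (Equiv.refl _)).trans (Equiv.prodAssoc _ _ _)).trans
      (((Equiv.refl _).prodCongr (pairEquiv b c)).trans (pairEquiv a (b * c))))

/-- The bijection of indices underlying `1 ⊗ X ≅ X`. -/
def leftEquiv (a : ℕ) : Fin (1 * a) ≃ Fin a :=
  (pairEquiv 1 a).symm.trans (Equiv.uniqueProd (Fin a) (Fin 1))

/-- The bijection of indices underlying `X ⊗ 1 ≅ X`. -/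
def rightEquiv (a : ℕ) : Fin (a * 1) ≃ Fin a :=
  (pairEquiv a 1).symm.trans (Equiv.prodUnique (Fin a) (Fin 1))

section Matrices

variable {R : Type} [CommRing R] {R' : Type} [CommRing R']

theorem kron_apply {p₁ n₁ p₂ n₂ : ℕ} (F : Matrix (Fin p₁) (Fin n₁) R)
    (G : Matrix (Fin p₂) (Fin n₂) R) (i : Fin (p₁ * p₂)) (j : Fin (n₁ * n₂)) :
    kron F G i j = F ((pairEquiv p₁ p₂).symm i).1 ((pairEquiv n₁ n₂).symm j).1 *
      G ((pairEquiv p₁ p₂).symm i).2 ((pairEquiv n₁ n₂).symm j).2 := rfl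

theorem kron_mul {p₁ n₁ m₁ p₂ n₂ m₂ : ℕ} (F : Matrix (Fin p₁) (Fin n₁) R)
    (G : Matrix (Fin p₂) (Fin n₂) R) (F' : Matrix (Fin n₁) (Fin m₁) R)
    (G' : Matrix (Fin n₂) (Fin m₂) R) :
    kron F G * kron F' G' = kron (F * F') (G * G') := by
  unfold kron
  rw [Matrix.submatrix_mul_equiv]
  exact congrArg (fun M => Matrix.submatrix M _ _) (Matrix.mul_kronecker_mul F F' G G').symm

theorem kron_one (n₁ n₂ : ℕ) :
    kron (1 : Matrix (Fin n₁) (Fin n₁) R) (1 : Matrix (Fin n₂) (Fin n₂) R) = 1 := by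
  have h : Matrix.kronecker (1 : Matrix (Fin n₁) (Fin n₁) R) (1 : Matrix (Fin n₂) (Fin n₂) R) = 1 :=
    Matrix.one_kronecker_one
  unfold kron
  rw [h, Matrix.submatrix_one_equiv]

theorem kron_map (f : R →+* R') {p₁ n₁ p₂ n₂ : ℕ} (F : Matrix (Fin p₁) (Fin n₁) R)
    (G : Matrix (Fin p₂) (Fin n₂) R) : (kron F G).map f = kron (F.map f) (G.map f) := by
  ext i j
  simp [kron_apply]

theorem permMat_mul {n m l : ℕ} (s : Fin n ≃ Fin m) (M : Matrix (Fin n) (Fin l) R) :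
    permMat R s * M = M.submatrix s.symm id := by
  ext i j
  simp [permMat, Matrix.mul_apply, Matrix.one_apply, ← Equiv.symm_apply_eq]

theorem mul_permMat {n m l : ℕ} (s : Fin n ≃ Fin m) (M : Matrix (Fin l) (Fin m) R) :
    M * permMat R s = M.submatrix id s := by
  ext i j
  simp [permMat, Matrix.mul_apply, Matrix.one_apply]

theorem permMat_map (f : R →+* R') {n m : ℕ} (s : Fin n ≃ Fin m) :
    (permMat R s).map f = permMat R' s := by
  ext i j
  simp [permMat, Matrix.one_apply, apply_ite f]

theorem permMat_mul_permMat {n m l : ℕ} (s : Fin n ≃ Fin m) (t : Fin m ≃ Fin l) :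
    permMat R t * permMat R s = permMat R (s.trans t) := by
  ext i j
  rw [mul_permMat]
  simp [permMat, Matrix.one_apply]

theorem permMat_refl (n : ℕ) : permMat R (Equiv.refl (Fin n)) = 1 := by
  ext i j
  simp [permMat, Matrix.one_apply]

theorem permMat_mul_symm {n m : ℕ} (s : Fin n ≃ Fin m) :
    permMat R s * permMat R s.symm = 1 := by
  rw [permMat_mul_permMat, Equiv.symm_trans_self, permMat_refl]

theorem permMat_symm_mul {n m : ℕ} (s : Fin n ≃ Fin m) :
    permMat R s.symm * permMat R s = 1 := by
  rw [permMat_mul_permMat, Equiv.self_trans_symm, permMat_refl]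

theorem kron_permMat {n m n' m' : ℕ} (s : Fin n ≃ Fin m) (t : Fin n' ≃ Fin m') :
    kron (permMat R s) (permMat R t) =
      permMat R (((pairEquiv n n').symm.trans (s.prodCongr t)).trans (pairEquiv m m')) := by
  ext i j
  obtain ⟨⟨a, b⟩, rfl⟩ := (pairEquiv m m').surjective i
  obtain ⟨⟨c, d⟩, rfl⟩ := (pairEquiv n n').surjective j
  by_cases h : a = s c <;> by_cases h' : b = t d <;>
    simp [kron_apply, permMat, Matrix.one_apply, h, h']

theorem kron_assoc_apply {a b c : ℕ} (L : Matrix (Fin a) (Fin a) R) (M : Matrix (Fin b) (Fin b) R)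
    (N : Matrix (Fin c) (Fin c) R) (i j : Fin (a * b * c)) :
    kron L (kron M N) (assocEquiv a b c i) (assocEquiv a b c j) = kron (kron L M) N i j := by
  simp [kron_apply, assocEquiv, mul_assoc]

theorem kron_left_apply {a : ℕ} (M : Matrix (Fin a) (Fin a) R) (i j : Fin (1 * a)) :
    M (leftEquiv a i) (leftEquiv a j) = kron (1 : Matrix (Fin 1) (Fin 1) R) M i j := by
  simp [kron_apply, leftEquiv, Matrix.one_apply, eq_iff_true_of_subsingleton]

theorem kron_right_apply {a : ℕ} (M : Matrix (Fin a) (Fin a) R) (i j : Fin (a * 1)) :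
    M (rightEquiv a i) (rightEquiv a j) = kron M (1 : Matrix (Fin 1) (Fin 1) R) i j := by
  simp [kron_apply, rightEquiv, Matrix.one_apply, eq_iff_true_of_subsingleton]

end Matrices

/-- An object `(ℂⁿ, A)`, `A ∈ GLₙ(ℂ)`: the system `σ X = A X` with constant coefficients. The
parameters `K` and `σ` only serve to select the morphisms. -/
structure FlatSys (K : Type) [CommRing K] [Algebra ℂ K] (σ : K →+* K) : Type where
  /-- the rank -/
  n : ℕ
  /-- the matrix of the system -/
  A : GL (Fin n) ℂ

namespace FlatSys

variable {K : Type} [CommRing K] [Algebra ℂ K] {σ : K →+* K}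

/-- The matrix of the system, with coefficients in `K`. -/
def mat (X : FlatSys K σ) : Matrix (Fin X.n) (Fin X.n) K :=
  (X.A : Matrix (Fin X.n) (Fin X.n) ℂ).map (algebraMap ℂ K)

/-- A morphism `(ℂⁿ, A) → (ℂᵖ, B)` with coefficients in `K`:
a matrix `F ∈ M_{p,n}(K)` such that `(σ F) A = B F`. -/
@[ext]
structure Hom (X Y : FlatSys K σ) : Type where
  /-- the matrix of the morphism -/
  F : Matrix (Fin Y.n) (Fin X.n) K
  comm : F.map σ * X.mat = Y.mat * F

instance : Category (FlatSys K σ) where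
  Hom X Y := Hom X Y
  id X := ⟨1, by
    have h : (1 : Matrix (Fin X.n) (Fin X.n) K).map σ = 1 :=
      Matrix.map_one σ (map_zero σ) (map_one σ)
    rw [h, one_mul, mul_one]⟩
  comp f g := ⟨g.F * f.F, by
    rw [Matrix.map_mul, Matrix.mul_assoc, f.comm, ← Matrix.mul_assoc, g.comm, Matrix.mul_assoc]⟩
  id_comp f := Hom.ext (Matrix.mul_one _)
  comp_id f := Hom.ext (Matrix.one_mul _)
  assoc f g h := Hom.ext (Matrix.mul_assoc _ _ _).symm

@[ext]
theorem hom_ext {X Y : FlatSys K σ} {f g : X ⟶ Y} (h : f.F = g.F) : f = g := Hom.ext h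

@[simp]
theorem id_F (X : FlatSys K σ) : (𝟙 X : X ⟶ X).F = 1 := rfl

@[simp]
theorem comp_F {X Y Z : FlatSys K σ} (f : X ⟶ Y) (g : Y ⟶ Z) : (f ≫ g).F = g.F * f.F := rfl

/-- `(ℂⁿ, A) ⊗ (ℂᵐ, B) = (ℂⁿᵐ, A ⊗ B)`. -/
def tensor (X Y : FlatSys K σ) : FlatSys K σ where
  n := X.n * Y.n
  A :=
    { val := kron (X.A : Matrix _ _ ℂ) (Y.A : Matrix _ _ ℂ)
      inv := kron ((X.A⁻¹ : GL (Fin X.n) ℂ) : Matrix _ _ ℂ) ((Y.A⁻¹ : GL (Fin Y.n) ℂ) : Matrix _ _ ℂ)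
      val_inv := by rw [kron_mul, Units.mul_inv, Units.mul_inv, kron_one]
      inv_val := by rw [kron_mul, Units.inv_mul, Units.inv_mul, kron_one] }

/-- The unit object `(ℂ, 1)`. -/
def unit : FlatSys K σ where
  n := 1
  A := 1

theorem tensor_mat (X Y : FlatSys K σ) : (tensor X Y).mat = kron X.mat Y.mat :=
  kron_map (algebraMap ℂ K) _ _

theorem unit_mat : (unit : FlatSys K σ).mat = 1 :=
  Matrix.map_one _ (map_zero _) (map_one _)

/-- The tensor product of morphisms is the Kronecker product of their matrices. -/
def tensorMap {X₁ Y₁ X₂ Y₂ : FlatSys K σ} (f : X₁ ⟶ Y₁) (g : X₂ ⟶ Y₂) :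
    tensor X₁ X₂ ⟶ tensor Y₁ Y₂ where
  F := kron f.F g.F
  comm := by
    rw [tensor_mat, tensor_mat]
    show (kron f.F g.F).map σ * kron X₁.mat X₂.mat = kron Y₁.mat Y₂.mat * kron f.F g.F
    rw [kron_map, kron_mul, kron_mul, f.comm, g.comm]

/-- A bijection of the indices that carries the matrix of `X` to that of `Y` is an isomorphism. -/
def isoOfEquiv {X Y : FlatSys K σ} (s : Fin X.n ≃ Fin Y.n)
    (h : ∀ i j, Y.mat (s i) (s j) = X.mat i j) : X ≅ Y where
  hom := ⟨permMat K s, by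
    rw [permMat_map, permMat_mul, mul_permMat]
    ext i j
    simp [← h]⟩
  inv := ⟨permMat K s.symm, by
    rw [permMat_map, permMat_mul, mul_permMat]
    ext i j
    simp [← h]⟩
  hom_inv_id := hom_ext (permMat_symm_mul s)
  inv_hom_id := hom_ext (permMat_mul_symm s)

instance : MonoidalCategoryStruct (FlatSys K σ) where
  tensorObj := tensor
  tensorHom f g := tensorMap f g
  whiskerLeft X _ _ f := tensorMap (𝟙 X) f
  whiskerRight f Y := tensorMap f (𝟙 Y)
  tensorUnit := unit
  associator X Y Z := isoOfEquiv (X := tensor (tensor X Y) Z) (Y := tensor X (tensor Y Z))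
    (assocEquiv X.n Y.n Z.n) (by
      rw [tensor_mat, tensor_mat, tensor_mat, tensor_mat]
      exact kron_assoc_apply X.mat Y.mat Z.mat)
  leftUnitor X := isoOfEquiv (X := tensor unit X) (Y := X) (leftEquiv X.n) (by
      rw [tensor_mat, unit_mat]
      exact kron_left_apply X.mat)
  rightUnitor X := isoOfEquiv (X := tensor X unit) (Y := X) (rightEquiv X.n) (by
      rw [tensor_mat, unit_mat]
      exact kron_right_apply X.mat)

theorem tensorHom_F {X₁ Y₁ X₂ Y₂ : FlatSys K σ} (f : X₁ ⟶ Y₁) (g : X₂ ⟶ Y₂) :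
    (f ⊗ₘ g).F = kron f.F g.F := rfl

theorem associator_F (X Y Z : FlatSys K σ) :
    (α_ X Y Z).hom.F = permMat K (assocEquiv X.n Y.n Z.n) := rfl

theorem leftUnitor_F (X : FlatSys K σ) : (λ_ X).hom.F = permMat K (leftEquiv X.n) := rfl

theorem rightUnitor_F (X : FlatSys K σ) : (ρ_ X).hom.F = permMat K (rightEquiv X.n) := rfl

instance : MonoidalCategory (FlatSys K σ) :=
  MonoidalCategory.ofTensorHom
    (id_tensorHom_id := fun X Y => hom_ext (kron_one X.n Y.n))
    (id_tensorHom := fun _ _ _ _ => rfl)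
    (tensorHom_id := fun _ _ => rfl)
    (tensorHom_comp_tensorHom := fun f₁ f₂ g₁ g₂ => hom_ext (kron_mul _ _ _ _))
    (associator_naturality := fun {X₁ X₂ X₃ Y₁ Y₂ Y₃} f₁ f₂ f₃ => hom_ext (by
      show permMat K (assocEquiv Y₁.n Y₂.n Y₃.n) * kron (kron f₁.F f₂.F) f₃.F =
        kron f₁.F (kron f₂.F f₃.F) * permMat K (assocEquiv X₁.n X₂.n X₃.n)
      rw [permMat_mul, mul_permMat]
      ext i j
      simp [kron_apply, assocEquiv, mul_assoc]))
    (leftUnitor_naturality := fun {X Y} f => hom_ext (by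
      show permMat K (leftEquiv Y.n) * kron (1 : Matrix (Fin 1) (Fin 1) K) f.F =
        f.F * permMat K (leftEquiv X.n)
      rw [permMat_mul, mul_permMat]
      ext i j
      simp [kron_apply, leftEquiv, Matrix.one_apply, eq_iff_true_of_subsingleton]))
    (rightUnitor_naturality := fun {X Y} f => hom_ext (by
      show permMat K (rightEquiv Y.n) * kron f.F (1 : Matrix (Fin 1) (Fin 1) K) =
        f.F * permMat K (rightEquiv X.n)
      rw [permMat_mul, mul_permMat]
      ext i j
      simp [kron_apply, rightEquiv, Matrix.one_apply, eq_iff_true_of_subsingleton]))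
    (pentagon := fun W X Y Z => hom_ext (by
      show (kron (1 : Matrix (Fin W.n) (Fin W.n) K) (permMat K (assocEquiv X.n Y.n Z.n)) *
          permMat K (assocEquiv W.n (X.n * Y.n) Z.n)) *
          kron (permMat K (assocEquiv W.n X.n Y.n)) (1 : Matrix (Fin Z.n) (Fin Z.n) K) =
        permMat K (assocEquiv W.n X.n (Y.n * Z.n)) * permMat K (assocEquiv (W.n * X.n) Y.n Z.n)
      rw [← permMat_refl, ← permMat_refl, kron_permMat, kron_permMat, permMat_mul_permMat,
        permMat_mul_permMat, permMat_mul_permMat]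
      congr 1
      ext i
      simp [assocEquiv]))
    (triangle := fun X Y => hom_ext (by
      show kron (1 : Matrix (Fin X.n) (Fin X.n) K) (permMat K (leftEquiv Y.n)) *
          permMat K (assocEquiv X.n 1 Y.n) =
        kron (permMat K (rightEquiv X.n)) (1 : Matrix (Fin Y.n) (Fin Y.n) K)
      rw [← permMat_refl, ← permMat_refl, kron_permMat, kron_permMat, permMat_mul_permMat]
      congr 1
      ext i
      simp [assocEquiv, leftEquiv, rightEquiv, Prod.map]))

end FlatSys

/-! ### Tensor automorphisms -/

theorem inv_isMonoidal {C D : Type*} [Category C] [MonoidalCategory C] [Category D]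
    [MonoidalCategory D] (F : C ⥤ D) [F.Monoidal] (e : F ≅ F) (h : NatTrans.IsMonoidal e.hom) :
    NatTrans.IsMonoidal e.inv := inferInstance

/-- `Aut^⊗(F)`: the group of monoidal natural automorphisms of a monoidal functor. -/
def AutTensor {C D : Type*} [Category C] [MonoidalCategory C] [Category D] [MonoidalCategory D]
    (F : C ⥤ D) [F.Monoidal] : Subgroup (Aut F) where
  carrier := {α | NatTrans.IsMonoidal α.hom}
  one_mem' := inferInstanceAs (NatTrans.IsMonoidal (𝟙 F))
  mul_mem' {α β} hα hβ := by
    have : NatTrans.IsMonoidal α.hom := hα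
    have : NatTrans.IsMonoidal β.hom := hβ
    exact inferInstanceAs (NatTrans.IsMonoidal (β.hom ≫ α.hom))
  inv_mem' {α} hα := inv_isMonoidal F α hα

/-! ### Fibre functors -/

/-- The identification `ℂⁿ ⊗ ℂᵐ = ℂⁿᵐ`. -/
def tensorPi (n m : ℕ) : TensorProduct ℂ (Fin n → ℂ) (Fin m → ℂ) ≃ₗ[ℂ] (Fin (n * m) → ℂ) :=
  (((Pi.basisFun ℂ (Fin n)).tensorProduct (Pi.basisFun ℂ (Fin m))).reindex
    (pairEquiv n m)).equivFun

theorem tensorPi_tmul {n m : ℕ} (x : Fin n → ℂ) (y : Fin m → ℂ) (i : Fin (n * m)) :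
    tensorPi n m (TensorProduct.tmul ℂ x y) i =
      x ((pairEquiv n m).symm i).1 * y ((pairEquiv n m).symm i).2 := by
  unfold tensorPi
  rw [Module.Basis.equivFun_apply, Module.Basis.repr_reindex_apply]
  obtain ⟨⟨a, b⟩, rfl⟩ := (pairEquiv n m).surjective i
  rw [Equiv.symm_apply_apply, Module.Basis.tensorProduct_repr_tmul_apply]
  simp [mul_comm]

theorem kron_mulVec {p₁ n₁ p₂ n₂ : ℕ} (F : Matrix (Fin p₁) (Fin n₁) ℂ)
    (G : Matrix (Fin p₂) (Fin n₂) ℂ) (x : Fin n₁ → ℂ) (y : Fin n₂ → ℂ) :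
    (kron F G).mulVec (tensorPi n₁ n₂ (TensorProduct.tmul ℂ x y)) =
      tensorPi p₁ p₂ (TensorProduct.tmul ℂ (F.mulVec x) (G.mulVec y)) := by
  funext i
  simp only [Matrix.mulVec, dotProduct, tensorPi_tmul, kron_apply]
  rw [← (pairEquiv n₁ n₂).sum_comp, Fintype.sum_prod_type, Finset.sum_mul_sum]
  simp [mul_mul_mul_comm]

theorem permMat_mulVec {n m : ℕ} (s : Fin n ≃ Fin m) (x : Fin n → ℂ) :
    (permMat ℂ s).mulVec x = x ∘ s.symm := by
  funext i
  simp [permMat, Matrix.mulVec, dotProduct, Matrix.one_apply, ← Equiv.symm_apply_eq]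

theorem kron_one_mulVec {p n m : ℕ} (F : Matrix (Fin p) (Fin n) ℂ) (x : Fin n → ℂ)
    (y : Fin m → ℂ) :
    tensorPi p m (TensorProduct.tmul ℂ (F.mulVec x) y) =
      (kron F (1 : Matrix (Fin m) (Fin m) ℂ)).mulVec
        (tensorPi n m (TensorProduct.tmul ℂ x y)) := by
  rw [kron_mulVec, Matrix.one_mulVec]

theorem one_kron_mulVec {p n m : ℕ} (F : Matrix (Fin p) (Fin n) ℂ) (x : Fin n → ℂ)
    (y : Fin m → ℂ) :
    tensorPi m p (TensorProduct.tmul ℂ y (F.mulVec x)) =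
      (kron (1 : Matrix (Fin m) (Fin m) ℂ) F).mulVec
        (tensorPi m n (TensorProduct.tmul ℂ y x)) := by
  rw [kron_mulVec, Matrix.one_mulVec]

theorem assoc_mulVec {a b c : ℕ} (x : Fin a → ℂ) (y : Fin b → ℂ) (z : Fin c → ℂ) :
    (permMat ℂ (assocEquiv a b c)).mulVec (tensorPi (a * b) c
      (TensorProduct.tmul ℂ (tensorPi a b (TensorProduct.tmul ℂ x y)) z)) =
    tensorPi a (b * c) (TensorProduct.tmul ℂ x (tensorPi b c (TensorProduct.tmul ℂ y z))) := by
  rw [permMat_mulVec]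
  funext i
  simp [tensorPi_tmul, assocEquiv, mul_assoc]

theorem left_mulVec {a : ℕ} (c : ℂ) (x : Fin a → ℂ) :
    c • x = (permMat ℂ (leftEquiv a)).mulVec (tensorPi 1 a
      (TensorProduct.tmul ℂ (fun _ => c) x)) := by
  rw [permMat_mulVec]
  funext i
  simp [tensorPi_tmul, leftEquiv]

theorem right_mulVec {a : ℕ} (c : ℂ) (x : Fin a → ℂ) :
    c • x = (permMat ℂ (rightEquiv a)).mulVec (tensorPi a 1
      (TensorProduct.tmul ℂ x (fun _ => c))) := by
  rw [permMat_mulVec]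
  funext i
  simp [tensorPi_tmul, rightEquiv, mul_comm]

namespace FlatSys

variable {K : Type} [CommRing K] [Algebra ℂ K] {σ : K →+* K}

section Fibre

variable (S : Subring K) (ev : S →+* ℂ)
  (hS : ∀ (X Y : FlatSys K σ) (f : X ⟶ Y) (i : Fin Y.n) (j : Fin X.n), f.F i j ∈ S)

/-- The matrix obtained by applying `ev` to all entries of a morphism. -/
def evMat {X Y : FlatSys K σ} (f : X ⟶ Y) : Matrix (Fin Y.n) (Fin X.n) ℂ :=
  Matrix.of fun i j => ev ⟨f.F i j, hS X Y f i j⟩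

theorem evMat_of_map {X Y : FlatSys K σ} (f : X ⟶ Y) (M : Matrix (Fin Y.n) (Fin X.n) S)
    (h : f.F = M.map S.subtype) : evMat S ev hS f = M.map ev := by
  ext i j
  simp only [evMat, Matrix.of_apply, Matrix.map_apply]
  congr 1
  ext
  simp [h]

/-- The entries of a morphism as elements of `S`. -/
def liftMat {X Y : FlatSys K σ} (f : X ⟶ Y) : Matrix (Fin Y.n) (Fin X.n) S :=
  Matrix.of fun i j => ⟨f.F i j, hS X Y f i j⟩

theorem liftMat_map {X Y : FlatSys K σ} (f : X ⟶ Y) : (liftMat S hS f).map S.subtype = f.F := rfl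

theorem evMat_eq {X Y : FlatSys K σ} (f : X ⟶ Y) : evMat S ev hS f = (liftMat S hS f).map ev := rfl

theorem evMat_id (X : FlatSys K σ) : evMat S ev hS (𝟙 X) = 1 := by
  rw [evMat_of_map S ev hS (𝟙 X) 1 (Matrix.map_one _ (map_zero _) (map_one _)).symm]
  exact Matrix.map_one _ (map_zero _) (map_one _)

theorem evMat_comp {X Y Z : FlatSys K σ} (f : X ⟶ Y) (g : Y ⟶ Z) :
    evMat S ev hS (f ≫ g) = evMat S ev hS g * evMat S ev hS f := by
  rw [evMat_of_map S ev hS (f ≫ g) (liftMat S hS g * liftMat S hS f)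
    (by rw [Matrix.map_mul, liftMat_map, liftMat_map, comp_F]), Matrix.map_mul]
  rfl

theorem evMat_tensor {X₁ Y₁ X₂ Y₂ : FlatSys K σ} (f : X₁ ⟶ Y₁) (g : X₂ ⟶ Y₂) :
    evMat S ev hS (f ⊗ₘ g) = kron (evMat S ev hS f) (evMat S ev hS g) := by
  refine (evMat_of_map S ev hS (f ⊗ₘ g) (kron (liftMat S hS f) (liftMat S hS g)) ?_).trans ?_
  · exact (kron_map S.subtype (liftMat S hS f) (liftMat S hS g)).symm
  · exact kron_map ev (liftMat S hS f) (liftMat S hS g)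

theorem evMat_perm {X Y : FlatSys K σ} (f : X ⟶ Y) (s : Fin X.n ≃ Fin Y.n)
    (h : f.F = permMat K s) : evMat S ev hS f = permMat ℂ s := by
  rw [evMat_of_map S ev hS f (permMat S s) (by rw [permMat_map, h]), permMat_map]

/-- The functor `(ℂⁿ, A) ↦ ℂⁿ`, `F ↦ ev F`, for a ring homomorphism `ev` to `ℂ` that is defined on
a subring containing the entries of all morphisms. -/
def fibre : FlatSys K σ ⥤ FGModuleCat ℂ where
  obj X := FGModuleCat.of ℂ (Fin X.n → ℂ)
  map f := FGModuleCat.ofHom (evMat S ev hS f).mulVecLin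
  map_id X := by
    rw [evMat_id, Matrix.mulVecLin_one]
    rfl
  map_comp f g := by
    rw [evMat_comp, Matrix.mulVecLin_mul]
    rfl

theorem fibre_map_apply {X Y : FlatSys K σ} (f : X ⟶ Y) (x : Fin X.n → ℂ) :
    ((fibre S ev hS).map f).hom.hom x = (evMat S ev hS f).mulVec x := rfl

instance fibreMonoidal : (fibre S ev hS).Monoidal :=
  Functor.CoreMonoidal.toMonoidal
    { εIso := (LinearEquiv.funUnique (Fin 1) ℂ ℂ).symm.toFGModuleCatIso
      μIso := fun X Y => (tensorPi X.n Y.n).toFGModuleCatIso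
      μIso_hom_natural_left := by
        intro X Y f X'
        apply FGModuleCat.hom_ext
        refine TensorProduct.ext' fun x y => ?_
        show tensorPi Y.n X'.n (TensorProduct.tmul ℂ ((evMat S ev hS f).mulVec x) y) =
          (evMat S ev hS (f ⊗ₘ 𝟙 X')).mulVec (tensorPi X.n X'.n (TensorProduct.tmul ℂ x y))
        rw [evMat_tensor, evMat_id]
        exact kron_one_mulVec (evMat S ev hS f) x y
      μIso_hom_natural_right := by
        intro X Y X' f
        apply FGModuleCat.hom_ext
        refine TensorProduct.ext' fun x y => ?_
        show tensorPi X'.n Y.n (TensorProduct.tmul ℂ x ((evMat S ev hS f).mulVec y)) =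
          (evMat S ev hS (𝟙 X' ⊗ₘ f)).mulVec (tensorPi X'.n X.n (TensorProduct.tmul ℂ x y))
        rw [evMat_tensor, evMat_id]
        exact one_kron_mulVec (evMat S ev hS f) y x
      associativity := by
        intro X Y Z
        apply FGModuleCat.hom_ext
        refine TensorProduct.ext_threefold fun x y z => ?_
        show (evMat S ev hS (α_ X Y Z).hom).mulVec (tensorPi (X.n * Y.n) Z.n
            (TensorProduct.tmul ℂ (tensorPi X.n Y.n (TensorProduct.tmul ℂ x y)) z)) =
          tensorPi X.n (Y.n * Z.n)
            (TensorProduct.tmul ℂ x (tensorPi Y.n Z.n (TensorProduct.tmul ℂ y z)))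
        rw [evMat_perm S ev hS _ _ (associator_F X Y Z)]
        exact assoc_mulVec x y z
      left_unitality := by
        intro X
        apply FGModuleCat.hom_ext
        refine TensorProduct.ext' fun c x => ?_
        show c • x = (evMat S ev hS (λ_ X).hom).mulVec (tensorPi 1 X.n
            (TensorProduct.tmul ℂ ((LinearEquiv.funUnique (Fin 1) ℂ ℂ).symm c) x))
        rw [evMat_perm S ev hS _ _ (leftUnitor_F X)]
        exact left_mulVec c x
      right_unitality := by
        intro X
        apply FGModuleCat.hom_ext
        refine TensorProduct.ext' fun x c => ?_
        show c • x = (evMat S ev hS (ρ_ X).hom).mulVec (tensorPi X.n 1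
            (TensorProduct.tmul ℂ x ((LinearEquiv.funUnique (Fin 1) ℂ ℂ).symm c)))
        rw [evMat_perm S ev hS _ _ (rightUnitor_F X)]
        exact right_mulVec c x }

end Fibre
end FlatSys
/-! ### Convergent Laurent series -/

/-- The Laurent series `f = ∑ fₖ zᵏ` converges absolutely on the circle `|z| = r`. -/
def SummableAt (r : ℝ) (f : LaurentSeries ℂ) : Prop :=
  Summable fun k : ℤ => ‖f.coeff k‖ * r ^ k

theorem coeff_eq_zero_of_lt (f : LaurentSeries ℂ) : ∃ N : ℤ, ∀ k < N, f.coeff k = 0 := by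
  by_cases h : f = 0
  · exact ⟨0, fun k _ => by simp [h]⟩
  · exact ⟨f.order, fun k hk => HahnSeries.coeff_eq_zero_of_lt_order hk⟩

theorem hasSum_coeff_mul (f g : LaurentSeries ℂ) (k : ℤ) :
    HasSum (fun i : ℤ => f.coeff i * g.coeff (k - i)) ((f * g).coeff k) := by
  classical
  have h : (f * g).coeff k =
      ∑ i ∈ (Finset.antidiagonal f.isPWO_support g.isPWO_support k).image Prod.fst,
        f.coeff i * g.coeff (k - i) := by
    rw [HahnSeries.coeff_mul, Finset.sum_image]
    · refine Finset.sum_congr rfl fun p hp => ?_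
      rw [Finset.mem_antidiagonal] at hp
      rw [← hp.2.2, add_sub_cancel_left]
    · intro p hp p' hp' hpp
      have h1 := (Finset.mem_antidiagonal.mp hp).2.2
      have h2 := (Finset.mem_antidiagonal.mp hp').2.2
      ext
      · exact hpp
      · linarith
  rw [h]
  refine hasSum_sum_of_ne_finset_zero fun i hi => ?_
  by_contra hne
  refine hi (Finset.mem_image.mpr ⟨(i, k - i), ?_, rfl⟩)
  rw [Finset.mem_antidiagonal]
  exact ⟨left_ne_zero_of_mul hne, right_ne_zero_of_mul hne, by simp⟩

theorem SummableAt.prod {r : ℝ} (hr : 0 < r) {f g : LaurentSeries ℂ} (hf : SummableAt r f)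
    (hg : SummableAt r g) :
    Summable fun p : ℤ × ℤ =>
      ‖f.coeff p.2‖ * ‖g.coeff (p.1 - p.2)‖ * r ^ p.1 := by
  have h := hf.mul_of_nonneg hg (fun k => by positivity) (fun k => by positivity)
  let e : ℤ × ℤ ≃ ℤ × ℤ :=
    { toFun := fun p => (p.2, p.1 - p.2)
      invFun := fun p => (p.1 + p.2, p.1)
      left_inv := fun p => by ext <;> simp
      right_inv := fun p => by ext <;> simp }
  refine (e.summable_iff.mpr h).congr fun p => ?_
  simp only [Function.comp, e, Equiv.coe_fn_mk]
  have : r ^ p.1 = r ^ p.2 * r ^ (p.1 - p.2) := by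
    rw [← zpow_add₀ hr.ne']; congr 1; ring
  rw [this]
  ring

theorem SummableAt.mul {r : ℝ} (hr : 0 < r) {f g : LaurentSeries ℂ} (hf : SummableAt r f)
    (hg : SummableAt r g) : SummableAt r (f * g) := by
  have h := hf.prod hr hg
  refine Summable.of_nonneg_of_le (fun k => by positivity) (fun k => ?_) h.prod
  have hk := h.prod_factor k
  simp only [tsum_mul_right]
  gcongr
  rw [← (hasSum_coeff_mul f g k).tsum_eq]
  have hk' : Summable fun i : ℤ => ‖f.coeff i * g.coeff (k - i)‖ := by
    have := hk.mul_right ((r ^ k)⁻¹)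
    refine this.congr fun i => ?_
    rw [norm_mul]
    field_simp
  refine (norm_tsum_le_tsum_norm hk').trans_eq ?_
  simp

theorem SummableAt.of_finite {r : ℝ} {f : LaurentSeries ℂ} (h : f.support.Finite) :
    SummableAt r f := by
  refine summable_of_ne_finset_zero (s := h.toFinset) fun k hk => ?_
  have : f.coeff k = 0 := by simpa using hk
  simp [this]

theorem SummableAt.mono {r s : ℝ} (hs : 0 < s) (hsr : s ≤ r) {f : LaurentSeries ℂ}
    (hf : SummableAt r f) : SummableAt s f := by
  obtain ⟨N, hN⟩ := coeff_eq_zero_of_lt f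
  have hr : 0 < r := hs.trans_le hsr
  refine Summable.of_nonneg_of_le (fun k => by positivity) (fun k => ?_)
    (hf.mul_right ((s / r) ^ N))
  by_cases hk : k < N
  · simp [hN k hk]
  · have h1 : (s / r) ^ k ≤ (s / r) ^ N :=
      zpow_le_zpow_right_of_le_one₀ (by positivity) ((div_le_one hr).mpr hsr) (not_lt.mp hk)
    have h2 : s ^ k = r ^ k * (s / r) ^ k := by
      rw [div_zpow]; field_simp
    rw [h2, mul_assoc]
    gcongr

/-- The ring of Laurent series (with finite principal part) that converge absolutely on the
circle `|z| = r`. -/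
def summableRing (r : ℝ) (hr : 0 < r) : Subring (LaurentSeries ℂ) where
  carrier := {f | SummableAt r f}
  mul_mem' hf hg := SummableAt.mul hr hf hg
  one_mem' := SummableAt.of_finite ((Set.finite_singleton 0).subset HahnSeries.support_single_subset)
  add_mem' {f g} hf hg := by
    refine Summable.of_nonneg_of_le (fun k => by positivity) (fun k => ?_) (Summable.add hf hg)
    rw [← add_mul, HahnSeries.coeff_add]
    gcongr
    exact norm_add_le _ _
  zero_mem' := SummableAt.of_finite (by simp)
  neg_mem' {f} hf := by
    refine Summable.congr hf fun k => ?_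
    simp

/-- `ℂ({z})`: the convergent Laurent series, i.e. germs at `0` of meromorphic functions. -/
def ConvLaurent : Subring (LaurentSeries ℂ) where
  carrier := {f | ∃ r : ℝ, 0 < r ∧ SummableAt r f}
  mul_mem' := by
    rintro f g ⟨r, hr, hf⟩ ⟨s, hs, hg⟩
    have h := lt_min hr hs
    exact ⟨min r s, h, (hf.mono h (min_le_left _ _)).mul h (hg.mono h (min_le_right _ _))⟩
  one_mem' := ⟨1, one_pos, (summableRing 1 one_pos).one_mem⟩
  add_mem' := by
    rintro f g ⟨r, hr, hf⟩ ⟨s, hs, hg⟩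
    have h := lt_min hr hs
    exact ⟨min r s, h, (summableRing _ h).add_mem (hf.mono h (min_le_left _ _))
      (hg.mono h (min_le_right _ _))⟩
  zero_mem' := ⟨1, one_pos, (summableRing 1 one_pos).zero_mem⟩
  neg_mem' := by
    rintro f ⟨r, hr, hf⟩
    exact ⟨r, hr, (summableRing r hr).neg_mem hf⟩

theorem summableAt_C (r : ℝ) (c : ℂ) : SummableAt r (HahnSeries.C c) :=
  SummableAt.of_finite ((Set.finite_singleton 0).subset HahnSeries.support_single_subset)

/-- The constants `ℂ → ℂ({z})`. -/
def constSeries : ℂ →+* ConvLaurent :=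
  RingHom.codRestrict (HahnSeries.C : ℂ →+* LaurentSeries ℂ) ConvLaurent
    fun c => ⟨1, one_pos, summableAt_C 1 c⟩

instance : Algebra ℂ ConvLaurent := constSeries.toAlgebra

/-- `f(z) ↦ f(q z)` on formal Laurent series: the coefficient of `zᵏ` is multiplied by `qᵏ`. -/
def scale (q : ℂˣ) (f : LaurentSeries ℂ) : LaurentSeries ℂ where
  coeff k := (q : ℂ) ^ k * f.coeff k
  isPWO_support' := f.isPWO_support.mono fun k hk => by
    intro h
    exact hk (by simp [h])

theorem scale_coeff (q : ℂˣ) (f : LaurentSeries ℂ) (k : ℤ) :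
    (scale q f).coeff k = (q : ℂ) ^ k * f.coeff k := rfl

theorem scale_mul (q : ℂˣ) (f g : LaurentSeries ℂ) :
    scale q (f * g) = scale q f * scale q g := by
  ext k
  rw [scale_coeff]
  refine ((hasSum_coeff_mul f g k).mul_left ((q : ℂ) ^ k)).unique ?_
  have h := hasSum_coeff_mul (scale q f) (scale q g) k
  refine Eq.mp (congrArg (fun u => HasSum u _) (funext fun i => ?_)) h
  have hq : (q : ℂ) ^ k = (q : ℂ) ^ i * (q : ℂ) ^ (k - i) := by
    rw [← zpow_add₀ q.ne_zero]
    congr 1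
    ring
  rw [scale_coeff, scale_coeff, hq]
  ring

theorem SummableAt.scale {r : ℝ} (q : ℂˣ) {f : LaurentSeries ℂ} (hf : SummableAt r f) :
    SummableAt (r / ‖(q : ℂ)‖) (QDiff.scale q f) := by
  refine Summable.congr hf fun k => ?_
  have : ‖(q : ℂ)‖ ^ k ≠ 0 := zpow_ne_zero _ (by simp)
  rw [scale_coeff, norm_mul, norm_zpow, div_zpow]
  field_simp

/-- The automorphism `σ_q : f(z) ↦ f(q z)` of `ℂ({z})`. -/
def sigmaQ (q : ℂˣ) : ConvLaurent →+* ConvLaurent where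
  toFun f := ⟨scale q f.1, by
    obtain ⟨r, hr, hf⟩ := f.2
    exact ⟨r / ‖(q : ℂ)‖, div_pos hr (by simp), hf.scale q⟩⟩
  map_one' := by
    ext k
    show (q : ℂ) ^ k * (1 : LaurentSeries ℂ).coeff k = (1 : LaurentSeries ℂ).coeff k
    rw [HahnSeries.coeff_one]
    split_ifs with h <;> simp [h]
  map_zero' := by
    ext k
    show (q : ℂ) ^ k * (0 : LaurentSeries ℂ).coeff k = (0 : LaurentSeries ℂ).coeff k
    simp
  map_add' f g := by
    ext k
    exact mul_add _ _ _
  map_mul' f g := Subtype.ext (scale_mul q f.1 g.1)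

theorem eval_summable (z : ℂˣ) {f : LaurentSeries ℂ} (hf : SummableAt ‖(z : ℂ)‖ f) :
    Summable fun k : ℤ => ‖f.coeff k * (z : ℂ) ^ k‖ :=
  Summable.congr hf fun k => by rw [norm_mul, norm_zpow]

/-- The value at `z ≠ 0` of a Laurent series that converges absolutely at `z`. -/
def evalSeries (z : ℂˣ) (f : LaurentSeries ℂ) : ℂ := ∑' k : ℤ, f.coeff k * (z : ℂ) ^ k

theorem evalSeries_mul (z : ℂˣ) {f g : LaurentSeries ℂ} (hf : SummableAt ‖(z : ℂ)‖ f)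
    (hg : SummableAt ‖(z : ℂ)‖ g) : evalSeries z (f * g) = evalSeries z f * evalSeries z g := by
  have hz : 0 < ‖(z : ℂ)‖ := by simp
  let e : ℤ × ℤ ≃ ℤ × ℤ :=
    { toFun := fun p => (p.2, p.1 - p.2)
      invFun := fun p => (p.1 + p.2, p.1)
      left_inv := fun p => by ext <;> simp
      right_inv := fun p => by ext <;> simp }
  have hzk : ∀ k i : ℤ, (z : ℂ) ^ k = (z : ℂ) ^ i * (z : ℂ) ^ (k - i) := fun k i => by
    rw [← zpow_add₀ z.ne_zero]
    congr 1
    ring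
  have hs : Summable fun p : ℤ × ℤ => f.coeff p.2 * g.coeff (p.1 - p.2) * (z : ℂ) ^ p.1 := by
    refine Summable.of_norm ((hf.prod hz hg).congr fun p => ?_)
    rw [norm_mul, norm_mul, norm_zpow]
  unfold evalSeries
  rw [tsum_mul_tsum_of_summable_norm (eval_summable z hf) (eval_summable z hg), ← e.tsum_eq]
  have h1 : (fun p : ℤ × ℤ => f.coeff (e p).1 * (z : ℂ) ^ (e p).1 *
      (g.coeff (e p).2 * (z : ℂ) ^ (e p).2)) =
      fun p => f.coeff p.2 * g.coeff (p.1 - p.2) * (z : ℂ) ^ p.1 := by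
    funext p
    rw [hzk p.1 p.2]
    simp only [e, Equiv.coe_fn_mk]
    ring
  rw [h1, hs.tsum_prod]
  refine tsum_congr fun k => ?_
  simp only [tsum_mul_right]
  rw [(hasSum_coeff_mul f g k).tsum_eq]

/-- Evaluation at `z` as a ring homomorphism. -/
def evalHom (z : ℂˣ) :
    (summableRing ‖(z : ℂ)‖ (by simp)).comap ConvLaurent.subtype →+* ℂ where
  toFun f := evalSeries z f.1.1
  map_one' := by
    show ∑' k : ℤ, (1 : LaurentSeries ℂ).coeff k * (z : ℂ) ^ k = 1
    rw [tsum_eq_single 0]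
    · simp
    · intro k hk
      simp [HahnSeries.coeff_one, hk]
  map_zero' := by
    show ∑' k : ℤ, (0 : LaurentSeries ℂ).coeff k * (z : ℂ) ^ k = 0
    simp
  map_add' f g := by
    show ∑' k : ℤ, (f.1.1 + g.1.1).coeff k * (z : ℂ) ^ k = _
    simp only [HahnSeries.coeff_add, add_mul]
    exact (eval_summable z f.2).of_norm.tsum_add (eval_summable z g.2).of_norm
  map_mul' f g := evalSeries_mul z f.2 g.2


/-! ### The categories and their fibre functors -/

/-- The category `ℛ = Rep_ℂ(ℤ)`: objects `(ℂⁿ, A)`, morphisms the complex matrices `F` with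
`F A = B F`. -/
abbrev RepZ : Type := FlatSys ℂ (RingHom.id ℂ)

/-- The category `𝒫⁽⁰⁾` of flat `q`-difference systems: objects `(ℂⁿ, A)`, morphisms the matrices
`F` with coefficients in `ℂ({z})` such that `F(qz) A = B F(z)`. -/
abbrev P0 (q : ℂˣ) : Type := FlatSys ConvLaurent (sigmaQ q)

/-- The forgetful functor `ω : ℛ → Vect`, `(ℂⁿ, A) ↦ ℂⁿ`, `F ↦ F`. -/
def forgetR : RepZ ⥤ FGModuleCat ℂ :=
  FlatSys.fibre ⊤ (Subring.subtype ⊤) fun _ _ _ _ _ => Subring.mem_top _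

instance : forgetR.Monoidal := FlatSys.fibreMonoidal _ _ _

/-- The coefficient of `zᵏ`. -/
def coeffHom (k : ℤ) : ConvLaurent →+ ℂ where
  toFun f := f.1.coeff k
  map_zero' := rfl
  map_add' _ _ := rfl

theorem coeffHom_mul_const (k : ℤ) (f : ConvLaurent) (c : ℂ) :
    coeffHom k (f * algebraMap ℂ ConvLaurent c) = coeffHom k f * c :=
  HahnSeries.coeff_mul_single_zero

theorem coeffHom_const_mul (k : ℤ) (f : ConvLaurent) (c : ℂ) :
    coeffHom k (algebraMap ℂ ConvLaurent c * f) = c * coeffHom k f :=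
  HahnSeries.coeff_single_zero_mul

theorem P0.coeff_comm {q : ℂˣ} {X Y : P0 q} (f : X ⟶ Y) (k : ℤ) :
    (q : ℂ) ^ k • (f.F.map (coeffHom k) * X.A.val) = Y.A.val * f.F.map (coeffHom k) := by
  ext i j
  have h := congrArg (coeffHom k) (congrFun (congrFun f.comm i) j)
  rw [Matrix.mul_apply, Matrix.mul_apply, map_sum, map_sum] at h
  simp only [FlatSys.mat, Matrix.map_apply, coeffHom_mul_const, coeffHom_const_mul] at h
  rw [Matrix.smul_apply, Matrix.mul_apply, Matrix.mul_apply, smul_eq_mul, Finset.mul_sum]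
  simp only [Matrix.map_apply]
  rw [← h]
  refine Finset.sum_congr rfl fun l _ => ?_
  rw [← mul_assoc]
  rfl

section Bound

attribute [local instance] Matrix.linftyOpNormedAddCommGroup Matrix.linftyOpNormedSpace

/-- As `|q| > 1`, the coefficients of a morphism of `𝒫⁽⁰⁾` vanish in high degree. -/
theorem P0.coeff_eventually_zero {q : ℂˣ} (hq : 1 < ‖(q : ℂ)‖) {X Y : P0 q} (f : X ⟶ Y) :
    ∃ N : ℤ, ∀ k, N < k → f.F.map (coeffHom k) = 0 := by
  obtain ⟨N, hN⟩ := pow_unbounded_of_one_lt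
    (‖Y.A.val‖ * ‖X.A⁻¹.val‖) hq
  refine ⟨N, fun k hk => ?_⟩
  have h := congrArg (fun M => M * X.A⁻¹.val) (P0.coeff_comm f k)
  simp only [Matrix.smul_mul, Matrix.mul_assoc, Units.mul_inv, Matrix.mul_one] at h
  by_contra hne
  have hpos : 0 < ‖f.F.map (coeffHom k)‖ := norm_pos_iff.mpr hne
  have h1 := congrArg norm h
  rw [norm_smul, norm_zpow] at h1
  have h2 := (Matrix.linfty_opNorm_mul Y.A.val
    (f.F.map (coeffHom k) * X.A⁻¹.val)).trans
    (mul_le_mul_of_nonneg_left (Matrix.linfty_opNorm_mul (f.F.map (coeffHom k))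
      X.A⁻¹.val) (norm_nonneg _))
  rw [← h1] at h2
  have h3 : ‖(q : ℂ)‖ ^ N ≤ ‖(q : ℂ)‖ ^ k := by
    rw [← zpow_natCast]
    exact zpow_le_zpow_right₀ hq.le hk.le
  nlinarith [mul_lt_mul_of_pos_right (hN.trans_le h3) hpos]

end Bound

/-- The entries of a morphism of `𝒫⁽⁰⁾` are Laurent polynomials, so that they may be evaluated at
every `z ≠ 0`. -/
theorem P0.entry_finite {q : ℂˣ} (hq : 1 < ‖(q : ℂ)‖) {X Y : P0 q} (f : X ⟶ Y)
    (i : Fin Y.n) (j : Fin X.n) : (f.F i j).1.support.Finite := by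
  obtain ⟨N, hN⟩ := P0.coeff_eventually_zero hq f
  obtain ⟨M, hM⟩ := coeff_eq_zero_of_lt (f.F i j).1
  refine (Set.finite_Icc M N).subset fun k hk => ⟨?_, ?_⟩
  · by_contra h
    exact hk (hM k (not_le.mp h))
  · by_contra h
    exact hk (congrFun (congrFun (hN k (not_le.mp h)) i) j)

/-- The fibre functor `ω_{z₀}⁽⁰⁾ : 𝒫⁽⁰⁾ → Vect`, `(ℂⁿ, A) ↦ ℂⁿ`, `F ↦ F(z₀)`. -/
def omega (q : ℂˣ) (hq : 1 < ‖(q : ℂ)‖) (z₀ : ℂˣ) : P0 q ⥤ FGModuleCat ℂ :=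
  FlatSys.fibre _ (evalHom z₀) fun _ _ f i j => SummableAt.of_finite (P0.entry_finite hq f i j)

instance (q : ℂˣ) (hq : 1 < ‖(q : ℂ)‖) (z₀ : ℂˣ) : (omega q hq z₀).Monoidal :=
  FlatSys.fibreMonoidal _ _ _

/-- The action of `ω_{z₀}⁽⁰⁾` on morphisms is evaluation at `z₀`. -/
theorem omega_map_apply (q : ℂˣ) (hq : 1 < ‖(q : ℂ)‖) (z₀ : ℂˣ) {X Y : P0 q} (f : X ⟶ Y)
    (x : Fin X.n → ℂ) :
    ((omega q hq z₀).map f).hom.hom x =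
      (f.F.map fun g : ConvLaurent => evalSeries z₀ g.1).mulVec x := rfl

theorem sigmaQ_const (q : ℂˣ) (c : ℂ) :
    sigmaQ q (algebraMap ℂ ConvLaurent c) = algebraMap ℂ ConvLaurent c := by
  ext k
  show (q : ℂ) ^ k * (HahnSeries.single (0 : ℤ) c).coeff k = (HahnSeries.single (0 : ℤ) c).coeff k
  by_cases h : k = 0
  · simp [h]
  · simp [HahnSeries.coeff_single_of_ne h]

theorem evalSeries_const (z : ℂˣ) (c : ℂ) :
    evalSeries z (algebraMap ℂ ConvLaurent c).1 = c := by
  show ∑' k : ℤ, (HahnSeries.single (0 : ℤ) c).coeff k * (z : ℂ) ^ k = c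
  rw [tsum_eq_single 0]
  · simp
  · intro k hk
    simp [HahnSeries.coeff_single_of_ne hk]

/-- The embedding `ℛ → 𝒫⁽⁰⁾`: the identity on objects, and a constant matrix `F` is considered as
a matrix with coefficients in `ℂ({z})`. -/
def inclR (q : ℂˣ) : RepZ ⥤ P0 q where
  obj X := ⟨X.n, X.A⟩
  map {X Y} f :=
    { F := f.F.map (algebraMap ℂ ConvLaurent)
      comm := by
        have h : (f.F.map (algebraMap ℂ ConvLaurent)).map (sigmaQ q) =
            f.F.map (algebraMap ℂ ConvLaurent) := by
          ext1 i j
          exact sigmaQ_const q _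
        rw [h]
        exact (Matrix.map_mul (f := algebraMap ℂ ConvLaurent)).symm.trans
          ((congrArg (fun M : Matrix _ _ ℂ => M.map (algebraMap ℂ ConvLaurent)) f.comm).trans
            Matrix.map_mul) }
  map_id X := FlatSys.hom_ext (Matrix.map_one _ (map_zero _) (map_one _))
  map_comp f g := FlatSys.hom_ext Matrix.map_mul

/-- `ω_{z₀}⁽⁰⁾` restricts to the forgetful functor `ω` on `ℛ`. -/
theorem omega_inclR_map (q : ℂˣ) (hq : 1 < ‖(q : ℂ)‖) (z₀ : ℂˣ) {X Y : RepZ} (f : X ⟶ Y) :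
    (omega q hq z₀).map ((inclR q).map f) = forgetR.map f := by
  apply FGModuleCat.hom_ext
  refine LinearMap.ext fun x => ?_
  refine (omega_map_apply q hq z₀ ((inclR q).map f) x).trans ?_
  have h : (((inclR q).map f).F.map fun g : ConvLaurent => evalSeries z₀ g.1) = f.F := by
    ext i j
    exact evalSeries_const z₀ _
  rw [h]
  rfl

/-- Restriction `Aut(ω_{z₀}⁽⁰⁾) → Aut(ω)` along `ℛ → 𝒫⁽⁰⁾`: the component at `(ℂⁿ, A)` is kept. -/
def restrictAut (q : ℂˣ) (hq : 1 < ‖(q : ℂ)‖) (z₀ : ℂˣ) (α : Aut (omega q hq z₀)) :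
    Aut forgetR :=
  NatIso.ofComponents (fun X => α.app ((inclR q).obj X)) fun f => by
    have h := α.hom.naturality ((inclR q).map f)
    rw [omega_inclR_map] at h
    exact h

/-- Restriction `Aut^⊗(ω_{z₀}⁽⁰⁾) → Aut^⊗(ω)`. -/
def restrict (q : ℂˣ) (hq : 1 < ‖(q : ℂ)‖) (z₀ : ℂˣ) :
    AutTensor (omega q hq z₀) →* AutTensor forgetR where
  toFun α := ⟨restrictAut q hq z₀ α.1,
    { unit := α.2.unit
      tensor := fun X Y => α.2.tensor ((inclR q).obj X) ((inclR q).obj Y) }⟩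
  map_one' := rfl
  map_mul' _ _ := rfl

/-- The matrix of the component at `(ℂⁿ, A)` of an automorphism of the forgetful functor. -/
def compMat (α : Aut forgetR) (X : RepZ) : Matrix (Fin X.n) (Fin X.n) ℂ :=
  LinearMap.toMatrix' (m := Fin X.n) (n := Fin X.n) (α.hom.app X).hom.hom

/-! ### The proalgebraic hull of `ℤ` -/

/-- `ℤ^alg = Hom_grp(ℂ*, ℂ*) × ℂ` (with `ℂ` as an additive group). -/
abbrev Zalg : Type := (ℂˣ →* ℂˣ) × Multiplicative ℂ

/-- The power `U^λ = ∑_{k ≥ 0} (λ choose k) (U - 1)^k` of a unipotent `n × n` matrix; the terms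
with `k ≥ n` vanish. -/
def unipotentPow {n : ℕ} (U : Matrix (Fin n) (Fin n) ℂ) (lam : ℂ) : Matrix (Fin n) (Fin n) ℂ :=
  ∑ k ∈ Finset.range n, Ring.choose lam k • (U - 1) ^ k

/-- The semisimple matrix `Q diag(c₁, …, cₙ) Q⁻¹`. -/
def conjDiag {n : ℕ} (Q : GL (Fin n) ℂ) (c : Fin n → ℂˣ) : Matrix (Fin n) (Fin n) ℂ :=
  (Q : Matrix _ _ ℂ) * Matrix.diagonal (fun i => (c i : ℂ)) *
    ((Q⁻¹ : GL (Fin n) ℂ) : Matrix _ _ ℂ)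

/-- `M = A^{(γ,λ)} = γ(A_s) A_u^λ`, where `A = A_s A_u` is the multiplicative Dunford decomposition
(`A_s = Q diag(c) Q⁻¹` semisimple, `A_u = U` unipotent, `A_s` and `A_u` commute) and
`γ(A_s) = Q diag(γ(c)) Q⁻¹`. -/
def IsIncarnation (g : Zalg) {n : ℕ} (A : GL (Fin n) ℂ) (M : Matrix (Fin n) (Fin n) ℂ) : Prop :=
  ∃ (Q : GL (Fin n) ℂ) (c : Fin n → ℂˣ) (U : Matrix (Fin n) (Fin n) ℂ),
    IsNilpotent (U - 1) ∧ Commute (conjDiag Q c) U ∧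
    (A : Matrix (Fin n) (Fin n) ℂ) = conjDiag Q c * U ∧
    M = conjDiag Q (fun i => g.1 (c i)) * unipotentPow U (Multiplicative.toAdd g.2)

/-- The subgroup `{(γ, λ) ∈ ℤ^alg | γ(q) = 1}`. -/
def localSubgroup (q : ℂˣ) : Subgroup Zalg where
  carrier := {g | g.1 q = 1}
  one_mem' := rfl
  mul_mem' {g h} hg hh := by
    show g.1 q * h.1 q = 1
    rw [show g.1 q = 1 from hg, show h.1 q = 1 from hh, one_mul]
  inv_mem' {g} hg := by
    show (g.1 q)⁻¹ = 1
    rw [show g.1 q = 1 from hg, inv_one]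

end QDiff

end

open CategoryTheory MonoidalCategory

noncomputable section

namespace QDiff

open Polynomial

/-! ### Powers of unipotent matrices -/

/-! A tensor automorphism of `forgetR` is a family of invertible matrices that commutes with all
intertwiners and is compatible with Kronecker products and the unit. That $A^{(\gamma,\lambda)}$ is
such a family rests on two facts. First, $U^\lambda$ is polynomial in $\lambda$ and is the ordinary
power at $\lambda=m\in\mathbf N$, so an identity between such matrices need only be checked on
ordinary powers (`matrix_map_eval_ext`, `unipotentPow_natCast`). Second, an intertwiner of $A$ and
$B$ also intertwines $A_s$ and $B_s$ (`semisimple_intertwine`), hence $\gamma(A_s)$ and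
$\gamma(B_s)$, hence the unipotent powers. Taking the identity as intertwiner shows that the choice
of decomposition does not matter.

Rank one systems recover $\gamma$ and a Jordan block of size 2 recovers $\lambda$, which gives
injectivity. For surjectivity, a tensor automorphism $\alpha$ sends a matrix coefficient
$m\mapsto\varphi(A^mv)$ to the number $\varphi(\alpha_Av)$. This number depends only on the function
of $m$, because $\alpha_A$ preserves $A$-invariant subspaces (`IsCoeff.eq_zero`). Direct sums and
tensor products make the assignment an algebra homomorphism. The Dunford decomposition writes every
coefficient as a polynomial expression in the functions $m\mapsto c^m$ and $m\mapsto m$, so $\alpha$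
is determined by its values there, which are $\gamma(c)$ and $\lambda$.

For `omega`, restriction is injective since both categories have the same objects. The coefficient
$F_k$ of $z^k$ in a morphism satisfies $q^kF_kA=BF_k$: it is a constant intertwiner of $q^kA$ and
$B$. As $(q^kA)^{(\gamma,\lambda)}=\gamma(q)^kA^{(\gamma,\lambda)}$, the condition $\gamma(q)=1$
makes every $F_k$, hence $F(z_0)=\sum z_0^kF_k$, commute with the family. Conversely, the morphism
$z:(\mathbf C,1)\to(\mathbf C,q)$ takes the nonzero value $z_0$ and forces $\gamma(q)=\gamma(1)=1$.
-/

/-- The polynomial `X (X - 1) ⋯ (X - k + 1) / k!`. -/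
def choosePoly (k : ℕ) : ℂ[X] :=
  C ((k.factorial : ℂ)⁻¹) * (descPochhammer ℤ k).map (Int.castRingHom ℂ)

theorem eval_choosePoly (k : ℕ) (z : ℂ) : (choosePoly k).eval z = Ring.choose z k := by
  rw [Ring.choose_eq_smul, ← aeval_eq_smeval, choosePoly, Polynomial.eval_mul, eval_C, Polynomial.eval_map,
    smul_eq_mul]
  rfl

/-- The matrix of polynomials in `λ` whose value is `U^λ`. -/
def unipotentPoly {n : ℕ} (U : Matrix (Fin n) (Fin n) ℂ) : Matrix (Fin n) (Fin n) ℂ[X] :=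
  ∑ k ∈ Finset.range n, choosePoly k • ((U - 1) ^ k).map C

theorem unipotentPoly_map {n : ℕ} (U : Matrix (Fin n) (Fin n) ℂ) (z : ℂ) :
    (unipotentPoly U).map (evalRingHom z) = unipotentPow U z := by
  ext i j
  simp [unipotentPoly, unipotentPow, Matrix.sum_apply, eval_finsetSum, eval_choosePoly]

theorem eval_natCast_ext {p r : ℂ[X]} (h : ∀ m : ℕ, p.eval (m : ℂ) = r.eval (m : ℂ)) : p = r := by
  refine eq_of_infinite_eval_eq p r
    ((Set.infinite_range_of_injective (Nat.cast_injective (R := ℂ))).mono ?_)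
  rintro _ ⟨m, rfl⟩
  exact h m

/-- Matrices of polynomials that agree at all natural numbers agree. -/
theorem matrix_map_eval_ext {p n : ℕ} {P R : Matrix (Fin p) (Fin n) ℂ[X]}
    (h : ∀ m : ℕ, P.map (evalRingHom (m : ℂ)) = R.map (evalRingHom (m : ℂ))) : P = R := by
  ext1 i j
  exact eval_natCast_ext fun m => congrFun (congrFun (h m) i) j

/-- Cayley–Hamilton: the characteristic polynomial differs from $X^n$ by a nilpotent element of
$\mathbf C[X]$, that is, by zero. This is why cutting the binomial series at $k<n$ loses nothing. -/
theorem nilpotent_pow_eq_zero {n : ℕ} {N : Matrix (Fin n) (Fin n) ℂ} (h : IsNilpotent N) :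
    N ^ n = 0 := by
  have h1 := (Matrix.isNilpotent_charpoly_sub_pow_of_isNilpotent h).eq_zero
  have h2 := Matrix.aeval_self_charpoly N
  rw [sub_eq_zero.mp h1] at h2
  simpa using h2

/-- Binomial expansion of $(1+(U-1))^m$. One sum stops at $n$ (nilpotency), the other at $m+1$
(vanishing binomials); both are extended to the longer of the two ranges. -/
theorem unipotentPow_natCast {n : ℕ} {U : Matrix (Fin n) (Fin n) ℂ} (h : IsNilpotent (U - 1))
    (m : ℕ) : unipotentPow U m = U ^ m := by
  have h1 : unipotentPow U m =
      ∑ k ∈ Finset.range (max n (m + 1)), (m.choose k : ℂ) • (U - 1) ^ k := by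
    unfold unipotentPow
    simp only [Ring.choose_natCast]
    refine Finset.sum_subset (Finset.range_mono (le_max_left _ _)) fun k _ hk => ?_
    rw [pow_eq_zero_of_le (not_lt.mp fun h => hk (Finset.mem_range.mpr h))
      (nilpotent_pow_eq_zero h), smul_zero]
  have h2 : U ^ m = ∑ k ∈ Finset.range (m + 1), (m.choose k : ℂ) • (U - 1) ^ k := by
    conv_lhs => rw [← sub_add_cancel U 1]
    rw [(Commute.one_right (U - 1)).add_pow]
    refine Finset.sum_congr rfl fun k _ => ?_
    rw [one_pow, mul_one, Nat.cast_smul_eq_nsmul, nsmul_eq_mul, Nat.cast_comm]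
  rw [h1, h2]
  refine (Finset.sum_subset (Finset.range_mono (le_max_right _ _)) fun k _ hk => ?_).symm
  rw [Nat.choose_eq_zero_of_lt (by simpa using hk), Nat.cast_zero, zero_smul]

/-- Both sides are polynomial in $z$ and agree at the natural numbers, where the claim is
$FU^m=V^mF$. -/
theorem unipotentPow_intertwine {n p : ℕ} {U : Matrix (Fin n) (Fin n) ℂ}
    {V : Matrix (Fin p) (Fin p) ℂ} (hU : IsNilpotent (U - 1)) (hV : IsNilpotent (V - 1))
    {F : Matrix (Fin p) (Fin n) ℂ} (h : F * U = V * F) (z : ℂ) :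
    F * unipotentPow U z = unipotentPow V z * F := by
  have hm : ∀ m : ℕ, F * U ^ m = V ^ m * F := fun m => by
    induction m with
    | zero => simp
    | succ m ih => rw [pow_succ, ← Matrix.mul_assoc, ih, Matrix.mul_assoc, h, ← Matrix.mul_assoc,
        pow_succ]
  have hF : ∀ z : ℂ, (F.map C).map (evalRingHom z) = F := fun z => by ext; simp
  have key : F.map C * unipotentPoly U = unipotentPoly V * F.map C := matrix_map_eval_ext fun m => by
    rw [Matrix.map_mul, Matrix.map_mul, hF, unipotentPoly_map, unipotentPoly_map,
      unipotentPow_natCast hU, unipotentPow_natCast hV, hm]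
  have := congrArg (fun M => M.map (evalRingHom z)) key
  simpa only [Matrix.map_mul, hF, unipotentPoly_map] using this

theorem unipotentPow_kron {n p : ℕ} {U : Matrix (Fin n) (Fin n) ℂ}
    {V : Matrix (Fin p) (Fin p) ℂ} (hU : IsNilpotent (U - 1)) (hV : IsNilpotent (V - 1))
    (hUV : IsNilpotent (kron U V - 1)) (z : ℂ) :
    unipotentPow (kron U V) z = kron (unipotentPow U z) (unipotentPow V z) := by
  have hm : ∀ m : ℕ, kron U V ^ m = kron (U ^ m) (V ^ m) := fun m => by
    induction m with
    | zero => simp [kron_one]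
    | succ m ih => rw [pow_succ, ih, kron_mul, ← pow_succ, ← pow_succ]
  have key : unipotentPoly (kron U V) = kron (unipotentPoly U) (unipotentPoly V) :=
    matrix_map_eval_ext fun m => by
      rw [kron_map, unipotentPoly_map, unipotentPoly_map, unipotentPoly_map,
        unipotentPow_natCast hU, unipotentPow_natCast hV, unipotentPow_natCast hUV, hm]
  rw [← unipotentPoly_map, key, kron_map, unipotentPoly_map, unipotentPoly_map]

/-- The two exponents are freed one at a time: `h1` keeps the second one natural and interpolates in
the first; the final `key` fixes the exponent `z` and interpolates in the other, using `h1`. -/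
theorem unipotentPow_add {n : ℕ} {U : Matrix (Fin n) (Fin n) ℂ} (hU : IsNilpotent (U - 1))
    (z w : ℂ) : unipotentPow U (z + w) = unipotentPow U z * unipotentPow U w := by
  have hshift : ∀ z w : ℂ, ((unipotentPoly U).map (compRingHom (X + C w))).map (evalRingHom z) =
      unipotentPow U (z + w) := fun z w => by
    rw [← unipotentPoly_map]
    ext i j
    simp
  have hconst : ∀ (M : Matrix (Fin n) (Fin n) ℂ) (z : ℂ), (M.map C).map (evalRingHom z) = M :=
    fun M z => by ext; simp
  have h1 : ∀ (m : ℕ) (z : ℂ), unipotentPow U (z + m) = unipotentPow U z * U ^ m := fun m z => by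
    have key : (unipotentPoly U).map (compRingHom (X + C (m : ℂ))) =
        unipotentPoly U * (U ^ m).map C := matrix_map_eval_ext fun l => by
      rw [hshift, Matrix.map_mul, unipotentPoly_map, hconst, unipotentPow_natCast hU,
        ← Nat.cast_add, unipotentPow_natCast hU, pow_add]
    rw [← hshift, key, Matrix.map_mul, unipotentPoly_map, hconst]
  have key : (unipotentPoly U).map (compRingHom (X + C z)) =
      (unipotentPow U z).map C * unipotentPoly U := matrix_map_eval_ext fun l => by
    rw [hshift, Matrix.map_mul, unipotentPoly_map, hconst, unipotentPow_natCast hU, add_comm, h1]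
  rw [add_comm, ← hshift, key, Matrix.map_mul, unipotentPoly_map, hconst]

theorem unipotentPow_zero {n : ℕ} {U : Matrix (Fin n) (Fin n) ℂ} (hU : IsNilpotent (U - 1)) :
    unipotentPow U 0 = 1 := by
  simpa using unipotentPow_natCast hU 0

theorem unipotentPow_one_left {n : ℕ} (z : ℂ) :
    unipotentPow (1 : Matrix (Fin n) (Fin n) ℂ) z = 1 := by
  have h : IsNilpotent ((1 : Matrix (Fin n) (Fin n) ℂ) - 1) := by simp
  have key : unipotentPoly (1 : Matrix (Fin n) (Fin n) ℂ) = (1 : Matrix (Fin n) (Fin n) ℂ).map C :=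
    matrix_map_eval_ext fun m => by
      rw [unipotentPoly_map, unipotentPow_natCast h, one_pow]
      ext i j
      simp [Matrix.one_apply, apply_ite]
  rw [← unipotentPoly_map, key]
  ext i j
  by_cases hij : i = j <;> simp [Matrix.one_apply, hij]

/-! ### The multiplicative Dunford decomposition -/

theorem conjDiag_mul {n : ℕ} (Q : GL (Fin n) ℂ) (c d : Fin n → ℂˣ) :
    conjDiag Q c * conjDiag Q d = conjDiag Q (c * d) := by
  simp only [conjDiag, Matrix.mul_assoc]
  rw [← Matrix.mul_assoc (Q⁻¹.val) Q.val, Units.inv_mul, Matrix.one_mul,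
    ← Matrix.mul_assoc (Matrix.diagonal _) (Matrix.diagonal _), Matrix.diagonal_mul_diagonal]
  simp

theorem conjDiag_one {n : ℕ} (Q : GL (Fin n) ℂ) : conjDiag Q 1 = 1 := by
  have h : Matrix.diagonal (fun _ : Fin n => (1 : ℂ)) = 1 := Matrix.diagonal_one
  simp [conjDiag, h]

theorem conjDiag_mul_inv {n : ℕ} (Q : GL (Fin n) ℂ) (c : Fin n → ℂˣ) :
    conjDiag Q c * conjDiag Q c⁻¹ = 1 := by
  rw [conjDiag_mul, mul_inv_cancel, conjDiag_one]

theorem conjDiag_inv_mul {n : ℕ} (Q : GL (Fin n) ℂ) (c : Fin n → ℂˣ) :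
    conjDiag Q c⁻¹ * conjDiag Q c = 1 := by
  rw [conjDiag_mul, inv_mul_cancel, conjDiag_one]

/-- In eigenbases, the operator $F\mapsto TF-FS$ attached to diagonalizable $T$, $S$ is itself
diagonal: it multiplies the entry $(i,j)$ by $d_i-c_j$. -/
theorem conj_commutator {n p : ℕ} (Q : GL (Fin n) ℂ) (c : Fin n → ℂˣ) (R : GL (Fin p) ℂ)
    (d : Fin p → ℂˣ) (F : Matrix (Fin p) (Fin n) ℂ) (i : Fin p) (j : Fin n) :
    (R⁻¹.val * (conjDiag R d * F - F * conjDiag Q c) * Q.val) i j =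
      ((d i : ℂ) - c j) * (R⁻¹.val * F * Q.val) i j := by
  have h : R⁻¹.val * (conjDiag R d * F - F * conjDiag Q c) * Q.val =
      Matrix.diagonal (fun i => (d i : ℂ)) * (R⁻¹.val * F * Q.val) -
        (R⁻¹.val * F * Q.val) * Matrix.diagonal (fun i => (c i : ℂ)) := by
    rw [Matrix.mul_sub, Matrix.sub_mul]
    congr 1
    · simp only [conjDiag, Matrix.mul_assoc]
      rw [← Matrix.mul_assoc R⁻¹.val R.val, Units.inv_mul, Matrix.one_mul]
    · simp only [conjDiag, Matrix.mul_assoc]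
      rw [Units.inv_mul, Matrix.mul_one]
  rw [h, Matrix.sub_apply, Matrix.diagonal_mul, Matrix.mul_diagonal]
  ring

theorem conj_eq_zero {n p : ℕ} (Q : GL (Fin n) ℂ) (R : GL (Fin p) ℂ)
    {F : Matrix (Fin p) (Fin n) ℂ} (h : R⁻¹.val * F * Q.val = 0) : F = 0 := by
  have h1 : R.val * (R⁻¹.val * F * Q.val) * Q⁻¹.val = F := by
    simp only [Matrix.mul_assoc, Units.mul_inv, Matrix.mul_one]
    rw [← Matrix.mul_assoc, Units.mul_inv, Matrix.one_mul]
  rw [← h1, h, Matrix.mul_zero, Matrix.zero_mul]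

/-! ### Intertwiners and the two factors of the decomposition -/

/-- A matrix intertwines two diagonalizable matrices if and only if, in bases of eigenvectors, its
entries vanish between different eigenvalues. -/
theorem conjDiag_intertwine_iff {n p : ℕ} (Q : GL (Fin n) ℂ) (c : Fin n → ℂˣ) (R : GL (Fin p) ℂ)
    (d : Fin p → ℂˣ) (F : Matrix (Fin p) (Fin n) ℂ) :
    F * conjDiag Q c = conjDiag R d * F ↔
      ∀ i j, (R⁻¹.val * F * Q.val) i j ≠ 0 → d i = c j := by
  constructor
  · intro h i j hij
    have h1 := conj_commutator Q c R d F i j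
    rw [h, sub_self, Matrix.mul_zero, Matrix.zero_mul, Matrix.zero_apply] at h1
    exact Units.ext (sub_eq_zero.mp ((mul_eq_zero.mp h1.symm).resolve_right hij))
  · intro h
    refine (sub_eq_zero.mp (conj_eq_zero Q R ?_)).symm
    ext i j
    rw [conj_commutator, Matrix.zero_apply]
    by_cases hij : (R⁻¹.val * F * Q.val) i j = 0
    · rw [hij, mul_zero]
    · rw [h i j hij, sub_self, zero_mul]

/-- The entrywise criterion involves only equalities between eigenvalues, which any map $\gamma$
preserves; multiplicativity plays no role here. -/
theorem conjDiag_intertwine_map {n p : ℕ} {Q : GL (Fin n) ℂ} {c : Fin n → ℂˣ} {R : GL (Fin p) ℂ}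
    {d : Fin p → ℂˣ} {F : Matrix (Fin p) (Fin n) ℂ} (γ : ℂˣ → ℂˣ)
    (h : F * conjDiag Q c = conjDiag R d * F) :
    F * conjDiag Q (fun i => γ (c i)) = conjDiag R (fun i => γ (d i)) * F := by
  rw [conjDiag_intertwine_iff] at h ⊢
  exact fun i j hij => congrArg γ (h i j hij)

/-- On $v$ the operators $s$ and $-t$ coincide, and commutation propagates this to powers. With $t$
nilpotent, some power of $s$ kills $v$. -/
theorem pow_apply_eq_of_add_apply_eq_zero {V : Type*} [AddCommGroup V] [Module ℂ V]
    {s t : Module.End ℂ V} (hst : Commute s t) {v : V} (h : (s + t) v = 0) (k : ℕ) :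
    (s ^ k) v = ((-t) ^ k) v := by
  induction k with
  | zero => simp
  | succ k ih =>
    have h1 : s v = (-t) v := by
      rw [LinearMap.neg_apply]
      exact eq_neg_of_add_eq_zero_left h
    rw [pow_succ, Module.End.mul_apply, h1, ← Module.End.mul_apply,
      (hst.neg_right.pow_left k).eq, Module.End.mul_apply, ih, ← Module.End.mul_apply, ← pow_succ']

/-- A matrix that intertwines two invertible matrices intertwines their semisimple parts. -/
theorem semisimple_intertwine {n p : ℕ} {Q : GL (Fin n) ℂ} {c : Fin n → ℂˣ}
    {U : Matrix (Fin n) (Fin n) ℂ} {R : GL (Fin p) ℂ} {d : Fin p → ℂˣ}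
    {V : Matrix (Fin p) (Fin p) ℂ} (hU : IsNilpotent (U - 1)) (hQU : Commute (conjDiag Q c) U)
    (hV : IsNilpotent (V - 1)) (hRV : Commute (conjDiag R d) V) {F : Matrix (Fin p) (Fin n) ℂ}
    (h : F * (conjDiag Q c * U) = conjDiag R d * V * F) :
    F * conjDiag Q c = conjDiag R d * F := by
  set S := conjDiag Q c with hS
  set T := conjDiag R d with hT
  -- On the space of $p\times n$ matrices, the hypothesis says that $F$ is killed by $TV\cdot-\cdot
  -- SU$. This operator is the sum of the diagonalizable $T\cdot-\cdot S$ and of a nilpotent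
  -- operator commuting with it, built from $T(V-1)$ and $S(U-1)$.
  let l (M : Matrix (Fin p) (Fin p) ℂ) : Module.End ℂ (Matrix (Fin p) (Fin n) ℂ) :=
    mulLeftLinearMap (Fin n) ℂ M
  let r (M : Matrix (Fin n) (Fin n) ℂ) : Module.End ℂ (Matrix (Fin p) (Fin n) ℂ) :=
    mulRightLinearMap (Fin p) ℂ M
  have hl : ∀ M N, Commute M N → Commute (l M) (l N) := fun M N hMN => by
    refine LinearMap.ext fun G => ?_
    show M * (N * G) = N * (M * G)
    rw [← Matrix.mul_assoc, hMN.eq, Matrix.mul_assoc]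
  have hr : ∀ M N, Commute M N → Commute (r M) (r N) := fun M N hMN => by
    refine LinearMap.ext fun G => ?_
    show (G * N) * M = (G * M) * N
    rw [Matrix.mul_assoc, ← hMN.eq, Matrix.mul_assoc]
  have hlr : ∀ M N, Commute (l M) (r N) := fun M N => by
    refine LinearMap.ext fun G => ?_
    exact (Matrix.mul_assoc M G N).symm
  have hlpow : ∀ M k, (l M) ^ k = l (M ^ k) := fun M k => by
    induction k with
    | zero => exact LinearMap.ext fun G => (Matrix.one_mul G).symm
    | succ k ih =>
      rw [pow_succ, ih]
      refine LinearMap.ext fun G => ?_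
      show M ^ k * (M * G) = M ^ (k + 1) * G
      rw [← Matrix.mul_assoc, pow_succ]
  have hrpow : ∀ M k, (r M) ^ k = r (M ^ k) := fun M k => by
    induction k with
    | zero => exact LinearMap.ext fun G => (Matrix.mul_one G).symm
    | succ k ih =>
      rw [pow_succ, ih]
      refine LinearMap.ext fun G => ?_
      show G * M * M ^ k = G * M ^ (k + 1)
      rw [Matrix.mul_assoc, pow_succ']
  have hlnil : IsNilpotent (l (T * (V - 1))) := by
    obtain ⟨k, hk⟩ := (hRV.sub_right (Commute.one_right _)).isNilpotent_mul_left hV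
    exact ⟨k, by rw [hlpow, hk]; exact LinearMap.ext fun G => Matrix.zero_mul G⟩
  have hrnil : IsNilpotent (r (S * (U - 1))) := by
    obtain ⟨k, hk⟩ := (hQU.sub_right (Commute.one_right _)).isNilpotent_mul_left hU
    exact ⟨k, by rw [hrpow, hk]; exact LinearMap.ext fun G => Matrix.mul_zero G⟩
  have hTV : Commute T (T * (V - 1)) :=
    (Commute.refl T).mul_right (hRV.sub_right (Commute.one_right _))
  have hSU : Commute S (S * (U - 1)) :=
    (Commute.refl S).mul_right (hQU.sub_right (Commute.one_right _))
  have hcomm : Commute (l T - r S) (l (T * (V - 1)) - r (S * (U - 1))) :=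
    ((hl _ _ hTV).sub_right (hlr _ _)).sub_left ((hlr _ _).symm.sub_right (hr _ _ hSU))
  have hnil : IsNilpotent (l (T * (V - 1)) - r (S * (U - 1))) :=
    (hlr _ _).isNilpotent_sub hlnil hrnil
  have hF : ((l T - r S) + (l (T * (V - 1)) - r (S * (U - 1)))) F = 0 := by
    show (T * F - F * S) + (T * (V - 1) * F - F * (S * (U - 1))) = 0
    rw [Matrix.mul_sub, Matrix.mul_sub, Matrix.sub_mul, Matrix.mul_sub, h]
    simp
  obtain ⟨k, hk⟩ := hnil.neg
  have hk' : ((l T - r S) ^ k) F = 0 := by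
    rw [pow_apply_eq_of_add_apply_eq_zero hcomm hF, hk, LinearMap.zero_apply]
  -- A power of a diagonal operator kills $F$, so $d_i-c_j=0$ wherever the entry of $F$ in the
  -- eigenbases is nonzero.
  have hentry : ∀ k i j, (R⁻¹.val * ((l T - r S) ^ k) F * Q.val) i j =
      ((d i : ℂ) - c j) ^ k * (R⁻¹.val * F * Q.val) i j := fun k i j => by
    induction k with
    | zero => simp
    | succ k ih =>
      rw [pow_succ', pow_succ', mul_assoc, ← ih]
      exact conj_commutator Q c R d _ i j
  rw [hS, hT, conjDiag_intertwine_iff]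
  intro i j hij
  have h0 := hentry k i j
  rw [hk', Matrix.mul_zero, Matrix.zero_mul, Matrix.zero_apply] at h0
  exact Units.ext (sub_eq_zero.mp (eq_zero_of_pow_eq_zero
    ((mul_eq_zero.mp h0.symm).resolve_right hij)))

/-- Incarnations of the same element of `ℤ^alg` are natural. -/
theorem IsIncarnation.intertwine {g : Zalg} {n p : ℕ} {A : GL (Fin n) ℂ} {B : GL (Fin p) ℂ}
    {M : Matrix (Fin n) (Fin n) ℂ} {N : Matrix (Fin p) (Fin p) ℂ} (hM : IsIncarnation g A M)
    (hN : IsIncarnation g B N) {F : Matrix (Fin p) (Fin n) ℂ} (h : F * A.val = B.val * F) :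
    F * M = N * F := by
  obtain ⟨Q, c, U, hU, hQU, hA, rfl⟩ := hM
  obtain ⟨R, d, V, hV, hRV, hB, rfl⟩ := hN
  rw [hA, hB] at h
  have hs := semisimple_intertwine hU hQU hV hRV h
  have hu : F * U = V * F := by
    -- Moving the semisimple part past $F$ leaves it on the left of both sides, where it can be
    -- cancelled.
    rw [← Matrix.mul_assoc, hs, Matrix.mul_assoc, Matrix.mul_assoc] at h
    have h1 := congrArg (fun G => conjDiag R d⁻¹ * G) h
    simp only [← Matrix.mul_assoc, conjDiag_inv_mul, Matrix.one_mul] at h1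
    exact h1
  rw [← Matrix.mul_assoc, conjDiag_intertwine_map _ hs, Matrix.mul_assoc,
    unipotentPow_intertwine hU hV hu, ← Matrix.mul_assoc]

/-- Naturality with respect to the identity of $A$, the two sides being computed from two possibly
different decompositions. -/
theorem IsIncarnation.unique {g : Zalg} {n : ℕ} {A : GL (Fin n) ℂ}
    {M N : Matrix (Fin n) (Fin n) ℂ} (hM : IsIncarnation g A M) (hN : IsIncarnation g A N) :
    M = N := by
  simpa using hM.intertwine hN (F := 1) (by simp)

/-! ### Existence of the decomposition -/

/-- A semisimple endomorphism of `ℂⁿ` has a basis of eigenvectors. -/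
theorem exists_eigenbasis {n : ℕ} {s : Module.End ℂ (Fin n → ℂ)} (hs : s.IsSemisimple) :
    ∃ (b : Module.Basis (Fin n) ℂ (Fin n → ℂ)) (μ : Fin n → ℂ), ∀ i, s (b i) = μ i • b i := by
  classical
  have hint : DirectSum.IsInternal fun μ : ℂ => s.eigenspace μ :=
    DirectSum.isInternal_submodule_of_iSupIndep_of_iSup_eq_top s.eigenspaces_iSupIndep
      hs.iSup_eigenspace_eq_top
  let b := hint.collectedBasis fun μ => Module.finBasis ℂ (s.eigenspace μ)
  let _ : Fintype (Σ μ : ℂ, Fin (Module.finrank ℂ (s.eigenspace μ))) :=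
    FiniteDimensional.fintypeBasisIndex b
  have hcard : Fintype.card (Σ μ : ℂ, Fin (Module.finrank ℂ (s.eigenspace μ))) = n := by
    rw [← Module.finrank_eq_card_basis b, Module.finrank_fin_fun]
  let e := Fintype.equivFinOfCardEq hcard
  refine ⟨b.reindex e, fun i => (e.symm i).1, fun i => ?_⟩
  rw [Module.Basis.reindex_apply]
  exact Module.End.mem_eigenspace_iff.mp (hint.collectedBasis_mem _ _)

theorem exists_mul_diagonal_mul_inv {n : ℕ} {s : Module.End ℂ (Fin n → ℂ)} (hs : s.IsSemisimple) :
    ∃ (Q : GL (Fin n) ℂ) (μ : Fin n → ℂ),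
      LinearMap.toMatrix' s = Q.val * Matrix.diagonal μ * Q⁻¹.val := by
  obtain ⟨b, μ, hb⟩ := exists_eigenbasis hs
  let Q : GL (Fin n) ℂ :=
    { val := (Pi.basisFun ℂ (Fin n)).toMatrix b
      inv := b.toMatrix (Pi.basisFun ℂ (Fin n))
      val_inv := Module.Basis.toMatrix_mul_toMatrix_flip _ _
      inv_val := Module.Basis.toMatrix_mul_toMatrix_flip _ _ }
  refine ⟨Q, μ, ?_⟩
  have h : LinearMap.toMatrix' s * Q.val = Q.val * Matrix.diagonal μ := by
    ext i j
    rw [Matrix.mul_diagonal]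
    have h1 : (LinearMap.toMatrix' s * Q.val) i j = ((LinearMap.toMatrix' s).mulVec (b j)) i := by
      simp [Matrix.mul_apply, Matrix.mulVec, dotProduct, Q, Module.Basis.toMatrix_apply]
    rw [h1, LinearMap.toMatrix'_mulVec, hb]
    simp [Q, Module.Basis.toMatrix_apply, mul_comm]
  rw [← h, Matrix.mul_assoc, Units.mul_inv, Matrix.mul_one]

/-- Additive Jordan–Chevalley decomposition; the two parts commute because both are polynomials in
$A$. -/
theorem exists_nilpotent_add_diagonalizable {n : ℕ} (A : Matrix (Fin n) (Fin n) ℂ) :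
    ∃ (N : Matrix (Fin n) (Fin n) ℂ) (Q : GL (Fin n) ℂ) (μ : Fin n → ℂ), IsNilpotent N ∧
      Commute N (Q.val * Matrix.diagonal μ * Q⁻¹.val) ∧
      A = N + Q.val * Matrix.diagonal μ * Q⁻¹.val := by
  obtain ⟨t, ht, s, hs, ⟨k, hk⟩, hss, hts⟩ :=
    Module.End.exists_isNilpotent_isSemisimple (f := Matrix.toLin' A)
  have hcomm : Commute s t := Algebra.commute_of_mem_adjoin_singleton_of_commute ht
    (Algebra.commute_of_mem_adjoin_self hs).symm
  obtain ⟨Q, μ, hQ⟩ := exists_mul_diagonal_mul_inv hss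
  refine ⟨LinearMap.toMatrix' t, Q, μ, ⟨k, ?_⟩, ?_, ?_⟩
  · have h := (map_pow (LinearMap.toMatrixAlgEquiv' (R := ℂ) (n := Fin n)) t k).symm
    rw [hk, map_zero] at h
    exact h
  · rw [← hQ]
    show LinearMap.toMatrix' t * LinearMap.toMatrix' s = LinearMap.toMatrix' s * LinearMap.toMatrix' t
    rw [← LinearMap.toMatrix'_mul, ← LinearMap.toMatrix'_mul, hcomm.eq]
  · rw [← hQ, ← map_add, ← hts, LinearMap.toMatrix'_toLin']

/-- From $A=S+N$: the part $S=A-N$ is a unit plus a commuting nilpotent, hence invertible with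
nonzero eigenvalues, and $A=S(1+S^{-1}N)$ with $S^{-1}N$ nilpotent. -/
theorem exists_dunford {n : ℕ} (A : GL (Fin n) ℂ) :
    ∃ (Q : GL (Fin n) ℂ) (c : Fin n → ℂˣ) (U : Matrix (Fin n) (Fin n) ℂ),
      IsNilpotent (U - 1) ∧ Commute (conjDiag Q c) U ∧ A.val = conjDiag Q c * U := by
  obtain ⟨N, Q, μ, hNnil, hNS, hA⟩ := exists_nilpotent_add_diagonalizable A.val
  obtain ⟨S, hQ⟩ : ∃ S, S = Q.val * Matrix.diagonal μ * Q⁻¹.val := ⟨_, rfl⟩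
  rw [← hQ] at hNS hA
  have hSunit : IsUnit S := by
    have h1 : S = A.val + -N := by rw [hA]; abel
    have hAN : Commute (-N) A.val := by
      rw [hA]
      exact ((Commute.refl N).add_right hNS).neg_left
    rw [h1]
    exact hNnil.neg.isUnit_add_left_of_commute A.isUnit hAN
  have hμ : ∀ i, μ i ≠ 0 := by
    have h1 : IsUnit (Matrix.diagonal μ) := by
      have h2 : Matrix.diagonal μ = Q⁻¹.val * S * Q.val := by
        rw [hQ]
        simp only [Matrix.mul_assoc, Units.inv_mul, Matrix.mul_one]
        rw [← Matrix.mul_assoc, Units.inv_mul, Matrix.one_mul]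
      rw [h2]
      exact (Q⁻¹.isUnit.mul hSunit).mul Q.isUnit
    rw [Matrix.isUnit_diagonal, Pi.isUnit_iff] at h1
    exact fun i => (h1 i).ne_zero
  have hSQ : S = conjDiag Q fun i => Units.mk0 (μ i) (hμ i) := hQ
  obtain ⟨c, hc⟩ : ∃ c, S = conjDiag Q c := ⟨_, hSQ⟩
  have hinv : Commute N (conjDiag Q c⁻¹) := by
    let u : (Matrix (Fin n) (Fin n) ℂ)ˣ :=
      ⟨conjDiag Q c, conjDiag Q c⁻¹, conjDiag_mul_inv Q c, conjDiag_inv_mul Q c⟩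
    have h1 : Commute N u.val := by rw [hc] at hNS; exact hNS
    exact h1.units_inv_right
  refine ⟨Q, c, 1 + conjDiag Q c⁻¹ * N, ?_, ?_, ?_⟩
  · rw [add_sub_cancel_left]
    exact hinv.symm.isNilpotent_mul_left hNnil
  · rw [← hc]
    refine (Commute.one_right _).add_right (Commute.mul_right ?_ hNS.symm)
    rw [hc]
    exact (conjDiag_mul_inv Q c).trans (conjDiag_inv_mul Q c).symm
  · rw [Matrix.mul_add, Matrix.mul_one, ← Matrix.mul_assoc, conjDiag_mul_inv, Matrix.one_mul, hA,
      hc, add_comm]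

theorem exists_isIncarnation (g : Zalg) {n : ℕ} (A : GL (Fin n) ℂ) : ∃ M, IsIncarnation g A M := by
  obtain ⟨Q, c, U, hU, hQU, hA⟩ := exists_dunford A
  exact ⟨_, Q, c, U, hU, hQU, hA, rfl⟩

/-! ### The matrices $A^{(\gamma,\lambda)}$ and their formal properties -/

/-- The matrix `A^{(γ,λ)}`. -/
def incarnation (g : Zalg) {n : ℕ} (A : GL (Fin n) ℂ) : Matrix (Fin n) (Fin n) ℂ :=
  (exists_isIncarnation g A).choose

theorem isIncarnation_incarnation (g : Zalg) {n : ℕ} (A : GL (Fin n) ℂ) :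
    IsIncarnation g A (incarnation g A) :=
  (exists_isIncarnation g A).choose_spec

theorem IsIncarnation.eq {g : Zalg} {n : ℕ} {A : GL (Fin n) ℂ} {M : Matrix (Fin n) (Fin n) ℂ}
    (h : IsIncarnation g A M) : incarnation g A = M :=
  (isIncarnation_incarnation g A).unique h

theorem incarnation_intertwine (g : Zalg) {n p : ℕ} {A : GL (Fin n) ℂ} {B : GL (Fin p) ℂ}
    {F : Matrix (Fin p) (Fin n) ℂ} (h : F * A.val = B.val * F) :
    F * incarnation g A = incarnation g B * F :=
  (isIncarnation_incarnation g A).intertwine (isIncarnation_incarnation g B) h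

/-- One decomposition serves all three elements. The factors can be regrouped because $A_u^\lambda$
commutes with $A_s$, hence with every $\gamma(A_s)$. -/
theorem incarnation_mul (g h : Zalg) {n : ℕ} (A : GL (Fin n) ℂ) :
    incarnation (g * h) A = incarnation g A * incarnation h A := by
  obtain ⟨Q, c, U, hU, hQU, hA⟩ := exists_dunford A
  rw [IsIncarnation.eq ⟨Q, c, U, hU, hQU, hA, rfl⟩,
    IsIncarnation.eq (g := g) ⟨Q, c, U, hU, hQU, hA, rfl⟩,
    IsIncarnation.eq (g := h) ⟨Q, c, U, hU, hQU, hA, rfl⟩]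
  have hcomm := unipotentPow_intertwine hU hU (hQU.eq) (Multiplicative.toAdd g.2)
  have h1 : conjDiag Q (fun i => h.1 (c i)) * unipotentPow U (Multiplicative.toAdd g.2) =
      unipotentPow U (Multiplicative.toAdd g.2) * conjDiag Q (fun i => h.1 (c i)) :=
    (conjDiag_intertwine_map h.1 hcomm.symm).symm
  rw [Matrix.mul_assoc, ← Matrix.mul_assoc (unipotentPow U (Multiplicative.toAdd g.2)), ← h1,
    Matrix.mul_assoc, ← unipotentPow_add hU, ← Matrix.mul_assoc, conjDiag_mul]
  rfl

theorem incarnation_one {n : ℕ} (A : GL (Fin n) ℂ) : incarnation 1 A = 1 := by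
  obtain ⟨Q, c, U, hU, hQU, hA⟩ := exists_dunford A
  rw [IsIncarnation.eq ⟨Q, c, U, hU, hQU, hA, rfl⟩]
  have h1 : conjDiag Q (fun i => (1 : Zalg).1 (c i)) = 1 := conjDiag_one Q
  have h2 : unipotentPow U (Multiplicative.toAdd (1 : Zalg).2) = 1 := unipotentPow_zero hU
  rw [h1, h2, one_mul]

theorem incarnation_mul_inv (g : Zalg) {n : ℕ} (A : GL (Fin n) ℂ) :
    incarnation g A * incarnation g⁻¹ A = 1 := by
  rw [← incarnation_mul, mul_inv_cancel (G := Zalg) g, incarnation_one]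

theorem incarnation_inv_mul (g : Zalg) {n : ℕ} (A : GL (Fin n) ℂ) :
    incarnation g⁻¹ A * incarnation g A = 1 := by
  rw [← incarnation_mul, inv_mul_cancel (G := Zalg) g, incarnation_one]

/-- Scaling by $a$ multiplies the semisimple part by $a$ and leaves the unipotent part alone, and
$\gamma$ is multiplicative. Applied to $a=q^k$, this brings in the condition on $\gamma(q)$. -/
theorem incarnation_smul (g : Zalg) {n : ℕ} {A B : GL (Fin n) ℂ} (a : ℂˣ)
    (h : B.val = (a : ℂ) • A.val) : incarnation g B = (g.1 a : ℂ) • incarnation g A := by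
  obtain ⟨Q, c, U, hU, hQU, hA⟩ := exists_dunford A
  have hsmul : ∀ (a : ℂˣ) (c : Fin n → ℂˣ), conjDiag Q (fun i => a * c i) =
      (a : ℂ) • conjDiag Q c := fun a c => by
    have h1 : Matrix.diagonal (fun i => ((a * c i : ℂˣ) : ℂ)) =
        (a : ℂ) • Matrix.diagonal fun i => (c i : ℂ) := by
      ext i j
      by_cases hij : i = j <;> simp [hij]
    rw [conjDiag, h1, Matrix.mul_smul, Matrix.smul_mul]
    rfl
  rw [IsIncarnation.eq (g := g) ⟨Q, c, U, hU, hQU, hA, rfl⟩]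
  refine IsIncarnation.eq ⟨Q, fun i => a * c i, U, hU, ?_, ?_, ?_⟩
  · rw [hsmul]
    exact hQU.smul_left _
  · rw [h, hA, hsmul, Matrix.smul_mul]
  · simp only [map_mul]
    rw [hsmul, Matrix.smul_mul]

theorem incarnation_rank_one (g : Zalg) (A : GL (Fin 1) ℂ) (a : ℂˣ) (h : A.val 0 0 = a) :
    incarnation g A 0 0 = g.1 a := by
  have h1 : A.val = (a : ℂ) • (1 : GL (Fin 1) ℂ).val := by
    ext i j
    rw [Subsingleton.elim i 0, Subsingleton.elim j 0, h]
    simp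
  have h2 : incarnation g (1 : GL (Fin 1) ℂ) = 1 := by
    refine IsIncarnation.eq ⟨1, 1, 1, by simp, Commute.one_right _, ?_, ?_⟩
    · rw [conjDiag_one, mul_one]
      rfl
    · have h3 : (fun i : Fin 1 => g.1 ((1 : Fin 1 → ℂˣ) i)) = 1 := by
        funext i
        simp
      rw [h3, conjDiag_one, unipotentPow_one_left, mul_one]
  rw [incarnation_smul g a h1, h2]
  simp

/-- An incarnation of a unipotent matrix. -/
theorem incarnation_unipotent (g : Zalg) {n : ℕ} (A : GL (Fin n) ℂ) (h : IsNilpotent (A.val - 1)) :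
    incarnation g A = unipotentPow A.val (Multiplicative.toAdd g.2) := by
  refine IsIncarnation.eq ⟨1, 1, A.val, h, ?_, ?_, ?_⟩
  · rw [conjDiag_one]
    exact Commute.one_left _
  · rw [conjDiag_one, one_mul]
  · have h3 : (fun i : Fin n => g.1 ((1 : Fin n → ℂˣ) i)) = 1 := by
      funext i
      simp
    rw [h3, conjDiag_one, one_mul]

/-! ### Compatibility with Kronecker products -/

/-- The Kronecker product of invertible matrices. -/
def kronGL {n p : ℕ} (A : GL (Fin n) ℂ) (B : GL (Fin p) ℂ) : GL (Fin (n * p)) ℂ where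
  val := kron A.val B.val
  inv := kron A⁻¹.val B⁻¹.val
  val_inv := by rw [kron_mul, Units.mul_inv, Units.mul_inv, kron_one]
  inv_val := by rw [kron_mul, Units.inv_mul, Units.inv_mul, kron_one]

theorem conjDiag_kronGL {n p : ℕ} (Q : GL (Fin n) ℂ) (c : Fin n → ℂˣ) (R : GL (Fin p) ℂ)
    (d : Fin p → ℂˣ) :
    conjDiag (kronGL Q R)
        (fun k => c ((pairEquiv n p).symm k).1 * d ((pairEquiv n p).symm k).2) =
      kron (conjDiag Q c) (conjDiag R d) := by
  have h : Matrix.diagonal (fun k : Fin (n * p) =>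
      ((c ((pairEquiv n p).symm k).1 * d ((pairEquiv n p).symm k).2 : ℂˣ) : ℂ)) =
      kron (Matrix.diagonal fun i => (c i : ℂ)) (Matrix.diagonal fun i => (d i : ℂ)) := by
    ext k l
    obtain ⟨⟨i, j⟩, rfl⟩ := (pairEquiv n p).surjective k
    obtain ⟨⟨i', j'⟩, rfl⟩ := (pairEquiv n p).surjective l
    by_cases hi : i = i' <;> by_cases hj : j = j' <;>
      simp [kron_apply, hi, hj]
  rw [conjDiag, h]
  show kron Q.val R.val * _ * kron Q⁻¹.val R⁻¹.val = _
  rw [kron_mul, kron_mul]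
  rfl

/-- $U\otimes V-1=(U-1)\otimes V+1\otimes(V-1)$ is a sum of commuting nilpotents. -/
theorem isNilpotent_kron_sub_one {n p : ℕ} {U : Matrix (Fin n) (Fin n) ℂ}
    {V : Matrix (Fin p) (Fin p) ℂ} (hU : IsNilpotent (U - 1)) (hV : IsNilpotent (V - 1)) :
    IsNilpotent (kron U V - 1) := by
  have hpow : ∀ (M : Matrix (Fin n) (Fin n) ℂ) (N : Matrix (Fin p) (Fin p) ℂ) (m : ℕ),
      kron M N ^ m = kron (M ^ m) (N ^ m) := fun M N m => by
    induction m with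
    | zero => simp [kron_one]
    | succ m ih => rw [pow_succ, ih, kron_mul, ← pow_succ, ← pow_succ]
  have h : kron U V - 1 = kron (U - 1) V + kron 1 (V - 1) := by
    rw [← kron_one]
    ext i j
    simp only [kron_apply, Matrix.sub_apply, Matrix.add_apply]
    ring
  rw [h]
  refine Commute.isNilpotent_add ?_ ?_ ?_
  · show kron (U - 1) V * kron 1 (V - 1) = kron 1 (V - 1) * kron (U - 1) V
    rw [kron_mul, kron_mul, one_mul, mul_one,
      ((Commute.refl V).sub_right (Commute.one_right V)).eq]
  · obtain ⟨k, hk⟩ := hU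
    refine ⟨k, ?_⟩
    rw [hpow, hk]
    ext i j
    simp [kron_apply]
  · obtain ⟨k, hk⟩ := hV
    refine ⟨k, ?_⟩
    rw [hpow, hk]
    ext i j
    simp [kron_apply]

/-- The Dunford decomposition of $A\otimes B$ is the product of those of the factors, with
eigenvalues $c_id_j$; then $\gamma(c_id_j)=\gamma(c_i)\gamma(d_j)$. -/
theorem incarnation_kronGL (g : Zalg) {n p : ℕ} (A : GL (Fin n) ℂ) (B : GL (Fin p) ℂ) :
    incarnation g (kronGL A B) = kron (incarnation g A) (incarnation g B) := by
  obtain ⟨Q, c, U, hU, hQU, hA⟩ := exists_dunford A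
  obtain ⟨R, d, V, hV, hRV, hB⟩ := exists_dunford B
  rw [IsIncarnation.eq (g := g) ⟨Q, c, U, hU, hQU, hA, rfl⟩,
    IsIncarnation.eq (g := g) ⟨R, d, V, hV, hRV, hB, rfl⟩]
  have hUV := isNilpotent_kron_sub_one hU hV
  refine IsIncarnation.eq ⟨kronGL Q R,
    fun k => c ((pairEquiv n p).symm k).1 * d ((pairEquiv n p).symm k).2, kron U V, hUV,
    ?_, ?_, ?_⟩
  · show conjDiag _ _ * _ = _ * conjDiag _ _
    rw [conjDiag_kronGL, kron_mul, kron_mul, hQU.eq, hRV.eq]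
  · show kron A.val B.val = _
    rw [conjDiag_kronGL, kron_mul, hA, hB]
  · simp only [map_mul]
    rw [conjDiag_kronGL Q (fun i => g.1 (c i)) R (fun i => g.1 (d i)),
      unipotentPow_kron hU hV hUV, kron_mul]

/-! ### Automorphisms of fibre functors and matrices -/

theorem matrix_ext_mulVec {n p : ℕ} {M N : Matrix (Fin p) (Fin n) ℂ}
    (h : ∀ x, M.mulVec x = N.mulVec x) : M = N :=
  Matrix.toLin'.injective (LinearMap.ext fun x => by
    rw [Matrix.toLin'_apply, Matrix.toLin'_apply, h])

theorem matrix_ext_tmul {n m p : ℕ} {M N : Matrix (Fin p) (Fin (n * m)) ℂ}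
    (h : ∀ x y, M.mulVec (tensorPi n m (TensorProduct.tmul ℂ x y)) =
      N.mulVec (tensorPi n m (TensorProduct.tmul ℂ x y))) : M = N := by
  refine matrix_ext_mulVec fun z => ?_
  obtain ⟨t, rfl⟩ := (tensorPi n m).surjective z
  induction t using TensorProduct.induction_on with
  | zero => rw [map_zero, Matrix.mulVec_zero, Matrix.mulVec_zero]
  | add s t hs ht => rw [map_add, Matrix.mulVec_add, Matrix.mulVec_add, hs, ht]
  | tmul x y => exact h x y

/-- The linear automorphism of `ℂⁿ` given by an invertible matrix. -/
def glEquiv {n : ℕ} (M : GL (Fin n) ℂ) : (Fin n → ℂ) ≃ₗ[ℂ] (Fin n → ℂ) where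
  toLinearMap := M.val.mulVecLin
  invFun x := M⁻¹.val.mulVec x
  left_inv x := by
    show M⁻¹.val.mulVec (M.val.mulVec x) = x
    rw [Matrix.mulVec_mulVec, Units.inv_mul, Matrix.one_mulVec]
  right_inv x := by
    show M.val.mulVec (M⁻¹.val.mulVec x) = x
    rw [Matrix.mulVec_mulVec, Units.mul_inv, Matrix.one_mulVec]

namespace FlatSys

variable {K : Type} [CommRing K] [Algebra ℂ K] {σ : K →+* K} (S : Subring K) (ev : S →+* ℂ)
  (hS : ∀ (X Y : FlatSys K σ) (f : X ⟶ Y) (i : Fin Y.n) (j : Fin X.n), f.F i j ∈ S)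

/-- The automorphism of a fibre functor given by a natural family of invertible matrices. -/
def autOfMatrices (M : ∀ X : FlatSys K σ, GL (Fin X.n) ℂ)
    (hM : ∀ (X Y : FlatSys K σ) (f : X ⟶ Y),
      evMat S ev hS f * (M X).val = (M Y).val * evMat S ev hS f) :
    Aut (fibre S ev hS) :=
  NatIso.ofComponents
    (fun X => (glEquiv (M X)).toFGModuleCatIso)
    fun {X Y} f => by
      apply FGModuleCat.hom_ext
      refine LinearMap.ext fun (x : Fin X.n → ℂ) => ?_
      show (M Y).val.mulVec ((evMat S ev hS f).mulVec x) =
        (evMat S ev hS f).mulVec ((M X).val.mulVec x)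
      rw [Matrix.mulVec_mulVec, Matrix.mulVec_mulVec, hM]

theorem autOfMatrices_mem (M : ∀ X : FlatSys K σ, GL (Fin X.n) ℂ)
    (hM : ∀ (X Y : FlatSys K σ) (f : X ⟶ Y),
      evMat S ev hS f * (M X).val = (M Y).val * evMat S ev hS f)
    (hunit : (M (𝟙_ (FlatSys K σ))).val = (1 : Matrix (Fin 1) (Fin 1) ℂ))
    (htensor : ∀ X Y : FlatSys K σ, (M (X ⊗ Y)).val = kron (M X).val (M Y).val) :
    autOfMatrices S ev hS M hM ∈ AutTensor (fibre S ev hS) where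
  unit := by
    apply FGModuleCat.hom_ext
    refine LinearMap.ext fun (c : ℂ) => ?_
    show (M (𝟙_ (FlatSys K σ))).val.mulVec ((LinearEquiv.funUnique (Fin 1) ℂ ℂ).symm c) =
      (LinearEquiv.funUnique (Fin 1) ℂ ℂ).symm c
    rw [hunit]
    exact Matrix.one_mulVec _
  tensor X Y := by
    apply FGModuleCat.hom_ext
    refine TensorProduct.ext' fun x y => ?_
    show (M (X ⊗ Y)).val.mulVec (tensorPi X.n Y.n (TensorProduct.tmul ℂ x y)) =
      tensorPi X.n Y.n (TensorProduct.tmul ℂ ((M X).val.mulVec x) ((M Y).val.mulVec y))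
    rw [htensor]
    exact kron_mulVec _ _ x y

end FlatSys

theorem compMat_mulVec (α : Aut forgetR) (X : RepZ) (x : Fin X.n → ℂ) :
    (compMat α X).mulVec x = (α.hom.app X).hom.hom x :=
  LinearMap.toMatrix'_mulVec (m := Fin X.n) (n := Fin X.n) (α.hom.app X).hom.hom x

theorem aut_ext {α β : Aut forgetR} (h : ∀ X, compMat α X = compMat β X) : α = β := by
  apply Iso.ext
  ext X : 2
  apply FGModuleCat.hom_ext
  refine LinearMap.ext fun (x : Fin X.n → ℂ) => ?_
  exact (compMat_mulVec α X x).symm.trans ((congrArg (·.mulVec x) (h X)).trans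
    (compMat_mulVec β X x))

theorem compMat_mul (α β : Aut forgetR) (X : RepZ) :
    compMat (α * β) X = compMat α X * compMat β X :=
  LinearMap.toMatrix'_comp (l := Fin X.n) (m := Fin X.n) (n := Fin X.n) (α.hom.app X).hom.hom
    (β.hom.app X).hom.hom

/-- A constant matrix `F` with `F A = B F` as a morphism of `ℛ`. -/
def repHom {X Y : RepZ} (F : Matrix (Fin Y.n) (Fin X.n) ℂ) (h : F * X.A.val = Y.A.val * F) :
    X ⟶ Y where
  F := F
  comm := h

theorem RepZ.comm {X Y : RepZ} (f : X ⟶ Y) : f.F * X.A.val = Y.A.val * f.F := f.comm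

theorem compMat_intertwine (α : Aut forgetR) {X Y : RepZ} {F : Matrix (Fin Y.n) (Fin X.n) ℂ}
    (h : F * X.A.val = Y.A.val * F) : F * compMat α X = compMat α Y * F := by
  refine matrix_ext_mulVec fun x => ?_
  rw [← Matrix.mulVec_mulVec, ← Matrix.mulVec_mulVec, compMat_mulVec, compMat_mulVec]
  have h1 := congrArg (fun φ => φ.hom.hom x) (α.hom.naturality (repHom F h))
  exact h1.symm

theorem compMat_unit {α : Aut forgetR} (hα : α ∈ AutTensor forgetR) :
    compMat α (𝟙_ RepZ) = (1 : Matrix (Fin 1) (Fin 1) ℂ) := by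
  refine matrix_ext_mulVec (n := 1) (p := 1) fun x => ?_
  rw [Matrix.one_mulVec]
  refine (compMat_mulVec α (𝟙_ RepZ) x).trans ?_
  have h1 := congrArg (fun φ => φ.hom.hom (x 0)) hα.unit
  have h2 : (LinearEquiv.funUnique (Fin 1) ℂ ℂ).symm (x 0) = x := by
    funext i
    rw [Subsingleton.elim i 0]
    rfl
  have h3 : (α.hom.app (𝟙_ RepZ)).hom.hom ((LinearEquiv.funUnique (Fin 1) ℂ ℂ).symm (x 0)) =
    (LinearEquiv.funUnique (Fin 1) ℂ ℂ).symm (x 0) := h1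
  rw [h2] at h3
  exact h3

theorem compMat_tensor {α : Aut forgetR} (hα : α ∈ AutTensor forgetR) (X Y : RepZ) :
    compMat α (X ⊗ Y) = kron (compMat α X) (compMat α Y) := by
  refine matrix_ext_tmul (n := X.n) (m := Y.n) (p := X.n * Y.n) fun x y => ?_
  refine (compMat_mulVec α (X ⊗ Y) _).trans ?_
  rw [kron_mulVec, compMat_mulVec, compMat_mulVec]
  exact congrArg (fun φ => φ.hom.hom (TensorProduct.tmul ℂ x y)) (hα.tensor X Y)

/-! ### The homomorphism `ℤ^alg → Aut^⊗(ω)` -/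

/-- The incarnation as an invertible matrix. -/
def incarnationGL (g : Zalg) {n : ℕ} (A : GL (Fin n) ℂ) : GL (Fin n) ℂ where
  val := incarnation g A
  inv := incarnation g⁻¹ A
  val_inv := incarnation_mul_inv g A
  inv_val := incarnation_inv_mul g A

theorem incarnation_identity (g : Zalg) : incarnation g (1 : GL (Fin 1) ℂ) = 1 := by
  ext i j
  rw [Subsingleton.elim i 0, Subsingleton.elim j 0,
    incarnation_rank_one g 1 1 (by simp)]
  simp

/-- The tensor automorphism `(ℂⁿ, A) ↦ A^{(γ,λ)}` of the forgetful functor. -/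
def autOfZalg (g : Zalg) : AutTensor forgetR :=
  ⟨FlatSys.autOfMatrices _ _ _ (fun X => incarnationGL g X.A)
      fun _ _ f => incarnation_intertwine g (RepZ.comm f),
    FlatSys.autOfMatrices_mem _ _ _ _ _ (incarnation_identity g)
      fun X Y => incarnation_kronGL g X.A Y.A⟩

theorem compMat_autOfZalg (g : Zalg) (X : RepZ) :
    compMat (autOfZalg g).1 X = incarnation g X.A :=
  matrix_ext_mulVec fun x => compMat_mulVec (autOfZalg g).1 X x

/-- The homomorphism `ℤ^alg → Aut^⊗(ω)`. -/
def zalgHom : Zalg →* AutTensor forgetR where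
  toFun := autOfZalg
  map_one' := Subtype.ext (aut_ext fun X => by
    rw [compMat_autOfZalg, incarnation_one]
    exact (LinearMap.toMatrix'_id (n := Fin X.n)).symm)
  map_mul' g h := Subtype.ext (aut_ext fun X => by
    rw [compMat_autOfZalg, incarnation_mul, Subgroup.coe_mul, compMat_mul, compMat_autOfZalg,
      compMat_autOfZalg])

/-- The invertible matrix `(c)` of size one. -/
def rankOneGL (c : ℂˣ) : GL (Fin 1) ℂ := Units.map (Matrix.scalar (Fin 1)).toMonoidHom c

theorem rankOneGL_apply (c : ℂˣ) : (rankOneGL c).val 0 0 = c := by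
  simp [rankOneGL]

/-- The invertible matrix `(1 1; 0 1)`. -/
def jordanTwo : GL (Fin 2) ℂ where
  val := !![1, 1; 0, 1]
  inv := !![1, -1; 0, 1]
  val_inv := by ext i j; fin_cases i <;> fin_cases j <;> simp
  inv_val := by ext i j; fin_cases i <;> fin_cases j <;> simp

theorem jordanTwo_sub_one : jordanTwo.val - 1 = !![0, 1; 0, 0] := by
  ext i j
  fin_cases i <;> fin_cases j <;> simp [jordanTwo]

/-- $(J-1)^2=0$, so $J^\lambda=1+\lambda(J-1)$ and the corner entry reads off $\lambda$. -/
theorem incarnation_jordanTwo (g : Zalg) :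
    incarnation g jordanTwo 0 1 = Multiplicative.toAdd g.2 := by
  have h : IsNilpotent (jordanTwo.val - 1) := by
    refine ⟨2, ?_⟩
    rw [jordanTwo_sub_one, pow_two]
    ext i j
    fin_cases i <;> fin_cases j <;> simp
  rw [incarnation_unipotent g _ h, unipotentPow, jordanTwo_sub_one, Finset.sum_range_succ,
    Finset.sum_range_one, Ring.choose_zero_right, Ring.choose_one_right, pow_zero, pow_one]
  simp

theorem zalgHom_injective : Function.Injective zalgHom := by
  intro g h hgh
  have hM : ∀ X : RepZ, incarnation g X.A = incarnation h X.A := fun X => by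
    rw [← compMat_autOfZalg, ← compMat_autOfZalg]
    exact congrArg (fun α : AutTensor forgetR => compMat α.1 X) hgh
  refine Prod.ext (MonoidHom.ext fun c => Units.ext ?_) ?_
  · rw [← incarnation_rank_one g (rankOneGL c) c (rankOneGL_apply c),
      ← incarnation_rank_one h (rankOneGL c) c (rankOneGL_apply c)]
    exact congrFun (congrFun (hM ⟨1, rankOneGL c⟩) 0) 0
  · refine Multiplicative.toAdd.injective ?_
    rw [← incarnation_jordanTwo, ← incarnation_jordanTwo]
    exact congrFun (congrFun (hM ⟨2, jordanTwo⟩) 0) 1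

/-! ### Matrix coefficients -/

/-- Every automorphism of a finite-dimensional vector space is given by an invertible matrix. -/
theorem exists_glEquiv_conj {V : Type*} [AddCommGroup V] [Module ℂ V] [FiniteDimensional ℂ V]
    (T : V ≃ₗ[ℂ] V) :
    ∃ (n : ℕ) (A : GL (Fin n) ℂ) (e : V ≃ₗ[ℂ] (Fin n → ℂ)), ∀ v, e (T v) = A.val.mulVec (e v) := by
  let b := Module.finBasis ℂ V
  let A : GL (Fin (Module.finrank ℂ V)) ℂ :=
    { val := LinearMap.toMatrix b b T
      inv := LinearMap.toMatrix b b T.symm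
      val_inv := by rw [← LinearMap.toMatrix_comp]; simp
      inv_val := by rw [← LinearMap.toMatrix_comp]; simp }
  refine ⟨_, A, b.equivFun, fun v => ?_⟩
  exact (LinearMap.toMatrix_mulVec_repr b b T.toLinearMap v).symm

/-- Naturality for linear maps rather than matrices, so that it applies to direct sums and invariant
subspaces once a basis has identified them with objects. -/
theorem compMat_linear (α : Aut forgetR) {n p : ℕ} {A : GL (Fin n) ℂ} {B : GL (Fin p) ℂ}
    (L : (Fin n → ℂ) →ₗ[ℂ] (Fin p → ℂ)) (h : ∀ v, L (A.val.mulVec v) = B.val.mulVec (L v))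
    (v : Fin n → ℂ) :
    L ((compMat α ⟨n, A⟩).mulVec v) = (compMat α ⟨p, B⟩).mulVec (L v) := by
  have h1 : LinearMap.toMatrix' L * A.val = B.val * LinearMap.toMatrix' L :=
    matrix_ext_mulVec fun x => by
      rw [← Matrix.mulVec_mulVec, ← Matrix.mulVec_mulVec, LinearMap.toMatrix'_mulVec,
        LinearMap.toMatrix'_mulVec, h]
  have h2 := congrArg (·.mulVec v)
    (compMat_intertwine α (X := ⟨n, A⟩) (Y := ⟨p, B⟩) (F := LinearMap.toMatrix' L) h1)
  simpa only [← Matrix.mulVec_mulVec, LinearMap.toMatrix'_mulVec] using h2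

theorem linear_pow {V : Type*} [AddCommGroup V] [Module ℂ V] {p : ℕ} {T : V → V}
    {B : Matrix (Fin p) (Fin p) ℂ} {L : V → (Fin p → ℂ)}
    (h : ∀ v, L (T v) = B.mulVec (L v)) (m : ℕ) (v : V) :
    L (T^[m] v) = (B ^ m).mulVec (L v) := by
  induction m with
  | zero => simp
  | succ m ih => rw [Function.iterate_succ_apply', h, ih, Matrix.mulVec_mulVec, ← pow_succ']

theorem iterate_mulVec {n : ℕ} (A : Matrix (Fin n) (Fin n) ℂ) (m : ℕ) (v : Fin n → ℂ) :
    A.mulVec^[m] v = (A ^ m).mulVec v :=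
  linear_pow (L := id) (fun _ => rfl) m v

/-- A pair `(f, z)` consisting of a matrix coefficient `m ↦ φ(Aᵐ v)` and of the corresponding
matrix coefficient `φ(α v)` of an automorphism `α`. -/
def IsCoeff (α : Aut forgetR) (x : (ℕ → ℂ) × ℂ) : Prop :=
  ∃ (n : ℕ) (A : GL (Fin n) ℂ) (φ : (Fin n → ℂ) →ₗ[ℂ] ℂ) (v : Fin n → ℂ),
    (∀ m, φ ((A.val ^ m).mulVec v) = x.1 m) ∧ φ ((compMat α ⟨n, A⟩).mulVec v) = x.2

/-- Realized on the direct sum $A\oplus B$, transported to some $\mathbf C^l$. Naturality for the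
two inclusions computes the component there; the tensor structure is not needed. -/
theorem IsCoeff.add {α : Aut forgetR} {x y : (ℕ → ℂ) × ℂ} (hx : IsCoeff α x) (hy : IsCoeff α y) :
    IsCoeff α (x + y) := by
  obtain ⟨n, A, φ, v, h1, h2⟩ := hx
  obtain ⟨p, B, ψ, w, k1, k2⟩ := hy
  obtain ⟨l, C, e, he⟩ := exists_glEquiv_conj ((glEquiv A).prodCongr (glEquiv B))
  have he' : ∀ v w, e (A.val.mulVec v, B.val.mulVec w) = C.val.mulVec (e (v, w)) :=
    fun v w => he (v, w)
  refine ⟨l, C, (φ.coprod ψ) ∘ₗ e.symm.toLinearMap, e (v, w), fun m => ?_, ?_⟩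
  · have h3 := linear_pow he m (v, w)
    have h4 : (⇑((glEquiv A).prodCongr (glEquiv B)))^[m] (v, w) =
        ((A.val ^ m).mulVec v, (B.val ^ m).mulVec w) := by
      rw [← iterate_mulVec, ← iterate_mulVec]
      exact congrFun (Prod.map_iterate _ _ m) (v, w)
    rw [h4] at h3
    rw [← h3]
    simp [h1, k1]
  · have h3 : e (v, w) = (e.toLinearMap ∘ₗ LinearMap.inl ℂ _ _) v +
        (e.toLinearMap ∘ₗ LinearMap.inr ℂ _ _) w := by
      simp [← map_add]
    rw [h3, Matrix.mulVec_add,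
      ← compMat_linear α (A := A) (e.toLinearMap ∘ₗ LinearMap.inl ℂ _ _)
        (fun v => by simpa using he' v 0),
      ← compMat_linear α (A := B) (e.toLinearMap ∘ₗ LinearMap.inr ℂ _ _)
        (fun w => by simpa using he' 0 w)]
    simp [h2, k2]

/-- Realized on $A\otimes B$ with the functional $\varphi\otimes\psi$ and the vector $v\otimes w$;
here compatibility with tensor products is essential. -/
theorem IsCoeff.mul {α : Aut forgetR} (hα : α ∈ AutTensor forgetR) {x y : (ℕ → ℂ) × ℂ}
    (hx : IsCoeff α x) (hy : IsCoeff α y) : IsCoeff α (x * y) := by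
  obtain ⟨n, A, φ, v, h1, h2⟩ := hx
  obtain ⟨p, B, ψ, w, k1, k2⟩ := hy
  let χ : (Fin (n * p) → ℂ) →ₗ[ℂ] ℂ :=
    LinearMap.mul' ℂ ℂ ∘ₗ TensorProduct.map φ ψ ∘ₗ (tensorPi n p).symm.toLinearMap
  have hχ : ∀ v w, χ (tensorPi n p (TensorProduct.tmul ℂ v w)) = φ v * ψ w := fun v w => by
    simp [χ]
  have hpow : ∀ m : ℕ, (kronGL A B).val ^ m = kron (A.val ^ m) (B.val ^ m) := fun m => by
    induction m with
    | zero => simp [kron_one]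
    | succ m ih =>
      rw [pow_succ, ih, pow_succ, pow_succ, ← kron_mul]
      rfl
  refine ⟨n * p, kronGL A B, χ, tensorPi n p (TensorProduct.tmul ℂ v w), fun m => ?_, ?_⟩
  · rw [hpow, kron_mulVec, hχ, h1, k1]
    rfl
  · have h3 : compMat α ⟨n * p, kronGL A B⟩ = kron (compMat α ⟨n, A⟩) (compMat α ⟨p, B⟩) :=
      compMat_tensor hα ⟨n, A⟩ ⟨p, B⟩
    rw [h3, kron_mulVec, hχ, h2, k2]
    rfl

theorem IsCoeff.const {α : Aut forgetR} (hα : α ∈ AutTensor forgetR) (c : ℂ) :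
    IsCoeff α (algebraMap ℂ ((ℕ → ℂ) × ℂ) c) := by
  refine ⟨1, 1, c • LinearMap.proj 0, 1, fun m => by simp, ?_⟩
  have h : compMat α ⟨1, 1⟩ = (1 : Matrix (Fin 1) (Fin 1) ℂ) := compMat_unit hα
  rw [h]
  simp

/-- The value of an automorphism on a matrix coefficient only depends on the function
`m ↦ φ(Aᵐ v)`, as the components of automorphisms preserve invariant subspaces. -/
theorem IsCoeff.eq_zero {α : Aut forgetR} {z : ℂ} (h : IsCoeff α (0, z)) : z = 0 := by
  obtain ⟨n, A, φ, v, h1, h2⟩ := h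
  -- The cyclic subspace generated by $v$: the vanishing of the coefficient function says that
  -- $\varphi$ is zero on it.
  let W : Submodule ℂ (Fin n → ℂ) := Submodule.span ℂ (Set.range fun m : ℕ => (A.val ^ m).mulVec v)
  have hW : W ≤ LinearMap.ker φ := Submodule.span_le.mpr (by
    rintro _ ⟨m, rfl⟩
    exact h1 m)
  have hAW : ∀ w ∈ W, A.val.mulVecLin w ∈ W := fun w hw => by
    have h3 : W ≤ W.comap A.val.mulVecLin := Submodule.span_le.mpr (by
      rintro _ ⟨m, rfl⟩
      refine Submodule.subset_span ⟨m + 1, ?_⟩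
      show (A.val ^ (m + 1)).mulVec v = A.val.mulVec ((A.val ^ m).mulVec v)
      rw [Matrix.mulVec_mulVec, ← pow_succ'])
    exact h3 hw
  have hinj : Function.Injective (A.val.mulVecLin.restrict hAW) := fun x y hxy =>
    Subtype.ext ((glEquiv A).injective (congrArg Subtype.val hxy))
  -- $A$ is injective on the finite-dimensional $W$, hence bijective there, so $W$ is an object with
  -- matrix `C` and its inclusion is a morphism. Naturality then puts $\alpha_Av$ in $W$.
  obtain ⟨l, C, e, he⟩ := exists_glEquiv_conj (LinearEquiv.ofInjectiveEndo _ hinj)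
  have hv : v ∈ W := Submodule.subset_span ⟨0, by simp⟩
  have h3 := compMat_linear α (A := C) (B := A) (W.subtype ∘ₗ e.symm.toLinearMap) (fun x => by
    have h4 := he (e.symm x)
    rw [e.apply_symm_apply] at h4
    rw [← h4]
    simp only [LinearMap.comp_apply, LinearEquiv.coe_coe, e.symm_apply_apply]
    rfl) (e ⟨v, hv⟩)
  have h5 : (W.subtype ∘ₗ e.symm.toLinearMap) (e ⟨v, hv⟩) = v := by simp
  rw [h5] at h3
  have h6 : (compMat α ⟨n, A⟩).mulVec v ∈ W := by
    rw [← h3]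
    exact Subtype.prop _
  exact h2.symm.trans (hW h6)

/-- The algebra of matrix coefficients, with their values under a tensor automorphism. -/
def coeffAlgebra {α : Aut forgetR} (hα : α ∈ AutTensor forgetR) : Subalgebra ℂ ((ℕ → ℂ) × ℂ) where
  carrier := {x | IsCoeff α x}
  mul_mem' hx hy := hx.mul hα hy
  add_mem' hx hy := hx.add hy
  algebraMap_mem' c := IsCoeff.const hα c

/-- Hence `coeffAlgebra` is the graph of an algebra homomorphism from matrix coefficients to
$\mathbf C$. -/
theorem coeffAlgebra_unique {α : Aut forgetR} (hα : α ∈ AutTensor forgetR) {f : ℕ → ℂ} {z w : ℂ}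
    (hz : (f, z) ∈ coeffAlgebra hα) (hw : (f, w) ∈ coeffAlgebra hα) : z = w := by
  have h := (coeffAlgebra hα).sub_mem hz hw
  rw [Prod.mk_sub_mk, sub_self] at h
  exact sub_eq_zero.mp (IsCoeff.eq_zero h)

theorem rankOne_mem_coeffAlgebra {α : Aut forgetR} (hα : α ∈ AutTensor forgetR) (c : ℂˣ) :
    ((fun m => (c : ℂ) ^ m, (compMat α ⟨1, rankOneGL c⟩ : Matrix (Fin 1) (Fin 1) ℂ) 0 0) :
      (ℕ → ℂ) × ℂ) ∈ coeffAlgebra hα := by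
  refine ⟨1, rankOneGL c, LinearMap.proj 0, 1, fun m => ?_, ?_⟩
  · have h : (rankOneGL c).val ^ m = Matrix.scalar (Fin 1) ((c : ℂ) ^ m) := by
      rw [map_pow]
      rfl
    rw [h]
    simp
  · simp [Matrix.mulVec, dotProduct]

theorem jordanTwo_pow (m : ℕ) : jordanTwo.val ^ m = !![1, (m : ℂ); 0, 1] := by
  induction m with
  | zero => ext i j; fin_cases i <;> fin_cases j <;> simp
  | succ m ih =>
    rw [pow_succ, ih]
    ext i j
    fin_cases i <;> fin_cases j <;> simp [jordanTwo, add_comm]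

theorem jordanTwo_mem_coeffAlgebra {α : Aut forgetR} (hα : α ∈ AutTensor forgetR) :
    ((fun m => (m : ℂ), (compMat α ⟨2, jordanTwo⟩ : Matrix (Fin 2) (Fin 2) ℂ) 0 1) :
      (ℕ → ℂ) × ℂ) ∈ coeffAlgebra hα := by
  refine ⟨2, jordanTwo, LinearMap.proj 0, Pi.single 1 1, fun m => ?_, ?_⟩
  · rw [jordanTwo_pow]
    simp
  · simp

theorem eval_mem_coeffAlgebra {α : Aut forgetR} (hα : α ∈ AutTensor forgetR) (p : ℂ[X]) :
    ((fun m => p.eval (m : ℂ),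
      p.eval ((compMat α ⟨2, jordanTwo⟩ : Matrix (Fin 2) (Fin 2) ℂ) 0 1)) : (ℕ → ℂ) × ℂ) ∈
      coeffAlgebra hα := by
  induction p using Polynomial.induction_on' with
  | add p r hp hr =>
    simp only [eval_add]
    exact (coeffAlgebra hα).add_mem hp hr
  | monomial k a =>
    simp only [eval_monomial]
    exact (coeffAlgebra hα).smul_mem
      ((coeffAlgebra hα).pow_mem (jordanTwo_mem_coeffAlgebra hα) k) a

/-- The character `γ` of `ℂ*` attached to a tensor automorphism. -/
def characterOf {α : Aut forgetR} (hα : α ∈ AutTensor forgetR) : ℂˣ →* ℂˣ :=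
  -- Multiplicativity comes from $(cd)^m=c^md^m$ in the algebra of coefficients; values are
  -- invertible because the source is a group.
  MonoidHom.toHomUnits
    { toFun := fun c => (compMat α ⟨1, rankOneGL c⟩ : Matrix (Fin 1) (Fin 1) ℂ) 0 0
      map_one' := by
        refine coeffAlgebra_unique hα (rankOne_mem_coeffAlgebra hα 1) ?_
        have h : (fun m : ℕ => ((1 : ℂˣ) : ℂ) ^ m) = 1 := by
          funext m
          simp
        rw [h]
        exact (coeffAlgebra hα).one_mem
      map_mul' := fun c d => by
        refine coeffAlgebra_unique hα (rankOne_mem_coeffAlgebra hα (c * d)) ?_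
        have h : (fun m : ℕ => ((c * d : ℂˣ) : ℂ) ^ m) =
            (fun m => (c : ℂ) ^ m) * fun m => (d : ℂ) ^ m := by
          funext m
          simp [mul_pow]
        rw [h]
        exact (coeffAlgebra hα).mul_mem (rankOne_mem_coeffAlgebra hα c)
          (rankOne_mem_coeffAlgebra hα d) }

theorem conjDiag_pow {n : ℕ} (Q : GL (Fin n) ℂ) (c : Fin n → ℂˣ) (m : ℕ) :
    conjDiag Q c ^ m = conjDiag Q (c ^ m) := by
  induction m with
  | zero => rw [pow_zero, pow_zero, conjDiag_one]
  | succ m ih => rw [pow_succ, ih, conjDiag_mul, pow_succ]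

/-- The matrix coefficients of `γ(A_s) A_u^λ`. -/
theorem conjDiag_mul_unipotentPow_coeff {n : ℕ} (Q : GL (Fin n) ℂ)
    (U : Matrix (Fin n) (Fin n) ℂ) (φ : (Fin n → ℂ) →ₗ[ℂ] ℂ) (v : Fin n → ℂ) :
    ∃ a : Fin n → ℕ → ℂ, ∀ (d : Fin n → ℂˣ) (z : ℂ),
      φ ((conjDiag Q d * unipotentPow U z).mulVec v) =
        ∑ k ∈ Finset.range n, ∑ i, a i k * ((d i : ℂ) * Ring.choose z k) := by
  -- These coefficients depend on neither `d` nor `z`, so the same ones expand both $A^m$ and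
  -- $\gamma(A_s)A_u^\lambda$.
  refine ⟨fun i k => φ (Q.val.mulVec (Pi.single i 1)) * (Q⁻¹.val.mulVec (((U - 1) ^ k).mulVec v)) i,
    fun d z => ?_⟩
  have hdiag : ∀ y : Fin n → ℂ, φ ((conjDiag Q d).mulVec y) =
      ∑ i, φ (Q.val.mulVec (Pi.single i 1)) * (Q⁻¹.val.mulVec y) i * (d i : ℂ) := fun y => by
    have h : (Matrix.diagonal fun i => (d i : ℂ)).mulVec (Q⁻¹.val.mulVec y) =
        ∑ i, ((d i : ℂ) * (Q⁻¹.val.mulVec y) i) • (Pi.single i 1 : Fin n → ℂ) := by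
      funext j
      simp [Matrix.mulVec_diagonal, Finset.sum_apply, Pi.single_apply]
    rw [conjDiag, ← Matrix.mulVec_mulVec, ← Matrix.mulVec_mulVec, h, Matrix.mulVec_sum, map_sum]
    refine Finset.sum_congr rfl fun i _ => ?_
    rw [Matrix.mulVec_smul, map_smul, smul_eq_mul]
    ring
  rw [unipotentPow, Matrix.mul_sum, Matrix.sum_mulVec, map_sum]
  refine Finset.sum_congr rfl fun k _ => ?_
  rw [Matrix.mul_smul, Matrix.smul_mulVec, map_smul, ← Matrix.mulVec_mulVec, hdiag, smul_eq_mul,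
    Finset.mul_sum]
  refine Finset.sum_congr rfl fun i _ => ?_
  ring

theorem zalgHom_surjective : Function.Surjective zalgHom := by
  rintro ⟨α, hα⟩
  -- The only possible preimage: $\gamma$ is read on rank one systems and $\lambda$ on the Jordan
  -- block.
  let g : Zalg := (characterOf hα,
    Multiplicative.ofAdd ((compMat α ⟨2, jordanTwo⟩ : Matrix (Fin 2) (Fin 2) ℂ) 0 1))
  refine ⟨g, Subtype.ext (aut_ext fun X => ?_)⟩
  refine (compMat_autOfZalg g X).trans ?_
  obtain ⟨n, A⟩ := X
  refine matrix_ext_mulVec fun v => funext fun j => ?_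
  show LinearMap.proj (R := ℂ) (φ := fun _ : Fin n => ℂ) j ((incarnation g A).mulVec v) =
    LinearMap.proj (R := ℂ) (φ := fun _ : Fin n => ℂ) j ((compMat α ⟨n, A⟩).mulVec v)
  set φ := LinearMap.proj (R := ℂ) (φ := fun _ : Fin n => ℂ) j with hφ
  have h1 : ((fun m => φ ((A.val ^ m).mulVec v), φ ((compMat α ⟨n, A⟩).mulVec v)) :
      (ℕ → ℂ) × ℂ) ∈ coeffAlgebra hα := ⟨n, A, φ, v, fun _ => rfl, rfl⟩
  refine coeffAlgebra_unique hα ?_ h1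
  obtain ⟨Q, c, U, hU, hQU, hA⟩ := exists_dunford A
  obtain ⟨a, ha⟩ := conjDiag_mul_unipotentPow_coeff Q U φ v
  -- A single linear combination of products of generators gives the function
  -- $m\mapsto\varphi(A^mv)$ in the first component and $\varphi(A^{(\gamma,\lambda)}v)$ in the
  -- second. Uniqueness of the value then identifies the latter with $\varphi(\alpha_Av)$.
  have h2 : ((fun m => φ ((A.val ^ m).mulVec v), φ ((incarnation g A).mulVec v)) : (ℕ → ℂ) × ℂ) =
      ∑ k ∈ Finset.range n, ∑ i, a i k •
        (((fun m => (c i : ℂ) ^ m, (compMat α ⟨1, rankOneGL (c i)⟩ : Matrix (Fin 1) (Fin 1) ℂ) 0 0) :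
          (ℕ → ℂ) × ℂ) *
        ((fun m => (choosePoly k).eval (m : ℂ), (choosePoly k).eval
          ((compMat α ⟨2, jordanTwo⟩ : Matrix (Fin 2) (Fin 2) ℂ) 0 1)) : (ℕ → ℂ) × ℂ)) := by
    refine Prod.ext (funext fun m => ?_) ?_
    · have h3 : A.val ^ m = conjDiag Q (c ^ m) * unipotentPow U m := by
        rw [hA, hQU.mul_pow, conjDiag_pow, unipotentPow_natCast hU]
      show φ ((A.val ^ m).mulVec v) = _
      rw [h3, ha]
      simp [Prod.fst_sum, Finset.sum_apply, eval_choosePoly]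
    · have h3 : incarnation g A = _ := IsIncarnation.eq ⟨Q, c, U, hU, hQU, hA, rfl⟩
      show φ ((incarnation g A).mulVec v) = _
      rw [h3, ha]
      simp only [Prod.snd_sum, Prod.smul_snd, Prod.snd_mul, eval_choosePoly, smul_eq_mul]
      rfl
  rw [h2]
  exact (coeffAlgebra hα).sum_mem fun k _ => (coeffAlgebra hα).sum_mem fun i _ =>
    (coeffAlgebra hα).smul_mem ((coeffAlgebra hα).mul_mem (rankOne_mem_coeffAlgebra hα (c i))
      (eval_mem_coeffAlgebra hα (choosePoly k))) (a i k)

/-! ### The fibre functor `ω_{z₀}⁽⁰⁾` -/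

/-- The isomorphism `ℤ^alg ≃ Aut^⊗(ω)`. -/
def zalgEquiv : Zalg ≃* AutTensor forgetR :=
  MulEquiv.ofBijective zalgHom ⟨zalgHom_injective, zalgHom_surjective⟩

/-- The two categories have the same objects and restriction keeps every component. -/
theorem restrict_injective (q : ℂˣ) (hq : 1 < ‖(q : ℂ)‖) (z₀ : ℂˣ)
    : Function.Injective (restrict q hq z₀) := by
  intro α β h
  refine Subtype.ext (Iso.ext ?_)
  ext X : 2
  exact congrArg (fun γ : AutTensor forgetR => γ.1.hom.app ⟨X.n, X.A⟩) h

/-- The hypothesis makes $F$ a constant intertwiner of $q^kA$ and $B$, and the scalar $\gamma(q)^k$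
that appears on $(q^kA)^{(\gamma,\lambda)}$ is 1. -/
theorem incarnation_intertwine_zpow {q : ℂˣ} {g : Zalg} (hg : g.1 q = 1) {n p : ℕ}
    {A : GL (Fin n) ℂ} {B : GL (Fin p) ℂ} (k : ℤ) {F : Matrix (Fin p) (Fin n) ℂ}
    (h : (q : ℂ) ^ k • (F * A.val) = B.val * F) :
    F * incarnation g A = incarnation g B * F := by
  let A' : GL (Fin n) ℂ := Units.map (Matrix.scalar (Fin n)).toMonoidHom (q ^ k) * A
  have hA' : A'.val = ((q ^ k : ℂˣ) : ℂ) • A.val := by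
    show Matrix.scalar (Fin n) ((q ^ k : ℂˣ) : ℂ) * A.val = _
    rw [Matrix.scalar_apply, ← Matrix.smul_eq_diagonal_mul]
  have h1 : F * A'.val = B.val * F := by
    rw [hA', Matrix.mul_smul, Units.val_zpow_eq_zpow_val, h]
  have h2 := incarnation_intertwine g h1
  rw [incarnation_smul g _ hA', map_zpow, hg, one_zpow, Units.val_one, one_smul] at h2
  exact h2

/-- The value at `z₀` of a morphism of `𝒫⁽⁰⁾`, as a finite sum over its coefficients. -/
theorem evalSeries_morphism (q : ℂˣ) (hq : 1 < ‖(q : ℂ)‖) (z₀ : ℂˣ)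
    {X Y : P0 q} (f : X ⟶ Y) :
    ∃ s : Finset ℤ, (f.F.map fun u : ConvLaurent => evalSeries z₀ u.1) =
      ∑ k ∈ s, (z₀ : ℂ) ^ k • f.F.map (coeffHom k) := by
  classical
  let s : Finset ℤ := Finset.univ.biUnion fun i => Finset.univ.biUnion fun j =>
    (P0.entry_finite hq f i j).toFinset
  refine ⟨s, ?_⟩
  ext i j
  rw [Matrix.map_apply, evalSeries, Matrix.sum_apply, tsum_eq_sum (s := s)]
  · refine Finset.sum_congr rfl fun k _ => ?_
    exact mul_comm _ _
  · intro k hk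
    have h : (f.F i j).1.coeff k = 0 := by
      by_contra hne
      refine hk (Finset.mem_biUnion.mpr ⟨i, Finset.mem_univ _, Finset.mem_biUnion.mpr
        ⟨j, Finset.mem_univ _, ?_⟩⟩)
      exact (Set.Finite.mem_toFinset _).mpr hne
    rw [h, zero_mul]

theorem incarnation_intertwine_eval (q : ℂˣ) (hq : 1 < ‖(q : ℂ)‖) (z₀ : ℂˣ)
    {g : Zalg} (hg : g.1 q = 1) {X Y : P0 q} (f : X ⟶ Y) :
    (f.F.map fun u : ConvLaurent => evalSeries z₀ u.1) * incarnation g X.A =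
      incarnation g Y.A * f.F.map fun u : ConvLaurent => evalSeries z₀ u.1 := by
  obtain ⟨s, hs⟩ := evalSeries_morphism q hq z₀ f
  rw [hs, Matrix.sum_mul, Matrix.mul_sum]
  refine Finset.sum_congr rfl fun k _ => ?_
  rw [Matrix.smul_mul, Matrix.mul_smul, incarnation_intertwine_zpow hg k (P0.coeff_comm f k)]

/-- The tensor automorphism of `ω_{z₀}⁽⁰⁾` attached to `(γ, λ)` with `γ(q) = 1`. -/
def autOfLocal (q : ℂˣ) (hq : 1 < ‖(q : ℂ)‖) (z₀ : ℂˣ)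
    (g : Zalg) (hg : g.1 q = 1) : AutTensor (omega q hq z₀) :=
  ⟨FlatSys.autOfMatrices _ _ _ (fun X => incarnationGL g X.A)
      fun _ _ f => incarnation_intertwine_eval q hq z₀ hg f,
    FlatSys.autOfMatrices_mem _ _ _ _ _ (incarnation_identity g)
      fun X Y => incarnation_kronGL g X.A Y.A⟩

theorem restrict_autOfLocal (q : ℂˣ) (hq : 1 < ‖(q : ℂ)‖) (z₀ : ℂˣ)
    (g : Zalg) (hg : g.1 q = 1) :
    restrict q hq z₀ (autOfLocal q hq z₀ g hg) = zalgEquiv g :=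
  Subtype.ext (Iso.ext (by ext X : 2; rfl))

/-! ### Necessity of $\gamma(q)=1$ -/

/-- The convergent Laurent series `z`. -/
def coordinate : ConvLaurent :=
  ⟨HahnSeries.single 1 1, 1, one_pos, SummableAt.of_finite
    ((Set.finite_singleton 1).subset HahnSeries.support_single_subset)⟩

/-- The morphism `z : (ℂ, 1) → (ℂ, q)` of `𝒫⁽⁰⁾`. -/
def coordinateHom (q : ℂˣ) : (⟨1, 1⟩ : P0 q) ⟶ ⟨1, rankOneGL q⟩ where
  F := (Matrix.of fun _ _ => coordinate : Matrix (Fin 1) (Fin 1) ConvLaurent)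
  comm := by
    refine Matrix.ext (m := Fin 1) (n := Fin 1) fun i j => ?_
    rw [Subsingleton.elim i 0, Subsingleton.elim j 0]
    refine (Matrix.mul_apply (m := Fin 1)).trans (Eq.trans ?_ (Matrix.mul_apply (m := Fin 1)).symm)
    rw [Fin.sum_univ_one, Fin.sum_univ_one]
    show sigmaQ q coordinate * algebraMap ℂ ConvLaurent ((1 : Matrix (Fin 1) (Fin 1) ℂ) 0 0) =
      algebraMap ℂ ConvLaurent ((rankOneGL q).val 0 0) * coordinate
    rw [Matrix.one_apply_eq, map_one, mul_one, rankOneGL_apply]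
    ext k
    refine Eq.trans ?_ (coeffHom_const_mul k coordinate q).symm
    show (q : ℂ) ^ k * (HahnSeries.single (1 : ℤ) (1 : ℂ)).coeff k =
      q * (HahnSeries.single (1 : ℤ) (1 : ℂ)).coeff k
    by_cases hk : k = 1
    · rw [hk, zpow_one]
    · rw [HahnSeries.coeff_single_of_ne hk, mul_zero, mul_zero]

theorem evalSeries_coordinate (z : ℂˣ) : evalSeries z coordinate.1 = z := by
  show ∑' k : ℤ, (HahnSeries.single (1 : ℤ) (1 : ℂ)).coeff k * (z : ℂ) ^ k = z
  rw [tsum_eq_single 1]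
  · simp
  · intro k hk
    rw [HahnSeries.coeff_single_of_ne hk, zero_mul]

theorem omega_map_coordinateHom (q : ℂˣ) (hq : 1 < ‖(q : ℂ)‖) (z₀ : ℂˣ) (x : Fin 1 → ℂ) :
    ((omega q hq z₀).map (coordinateHom q)).hom.hom x = (z₀ : ℂ) • x := by
  refine (omega_map_apply q hq z₀ (coordinateHom q) x).trans ?_
  refine funext fun (i : Fin 1) => ?_
  show ∑ j : Fin 1, evalSeries z₀ coordinate.1 * x j = z₀ * x i
  rw [Fin.sum_univ_one, evalSeries_coordinate, Subsingleton.elim i 0]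

/-- The naturality of an automorphism with respect to the morphism `z : (ℂ, 1) → (ℂ, q)` of
`𝒫⁽⁰⁾` forces `γ(q) = 1`. -/
theorem apply_q_eq_one (q : ℂˣ) (hq : 1 < ‖(q : ℂ)‖) (z₀ : ℂˣ) {g : Zalg}
    {α : AutTensor (omega q hq z₀)} (h : restrict q hq z₀ α = zalgEquiv g) : g.1 q = 1 := by
  have happ : ∀ (A : GL (Fin 1) ℂ) (x : Fin 1 → ℂ),
      (α.1.hom.app ⟨1, A⟩).hom.hom x = (incarnation g A).mulVec x := fun A x => by
    have h1 : compMat (restrict q hq z₀ α).1 ⟨1, A⟩ = incarnation g A := by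
      rw [h]
      exact compMat_autOfZalg g ⟨1, A⟩
    rw [← h1]
    exact (compMat_mulVec (restrict q hq z₀ α).1 ⟨1, A⟩ x).symm
  have hnat : (α.1.hom.app ⟨1, rankOneGL q⟩).hom.hom
        (((omega q hq z₀).map (coordinateHom q)).hom.hom (1 : Fin 1 → ℂ)) =
      ((omega q hq z₀).map (coordinateHom q)).hom.hom
        ((α.1.hom.app ⟨1, 1⟩).hom.hom (1 : Fin 1 → ℂ)) :=
    congrArg (fun φ => φ.hom.hom (1 : Fin 1 → ℂ)) (α.1.hom.naturality (coordinateHom q))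
  have hz : (incarnation g (rankOneGL q)).mulVec ((z₀ : ℂ) • (1 : Fin 1 → ℂ)) =
      (z₀ : ℂ) • (incarnation g (1 : GL (Fin 1) ℂ)).mulVec 1 := by
    rw [← happ, ← omega_map_coordinateHom q hq z₀, ← omega_map_coordinateHom q hq z₀, ← happ]
    exact hnat
  have h0 := congrFun hz 0
  rw [incarnation_identity, Matrix.one_mulVec, Matrix.mulVec_smul, Pi.smul_apply, Pi.smul_apply,
    smul_eq_mul, smul_eq_mul] at h0
  -- The naturality square reads $z_0\gamma(q)=z_0\gamma(1)=z_0$.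
  have h1 := mul_left_cancel₀ z₀.ne_zero h0
  have h2 : (incarnation g (rankOneGL q)).mulVec 1 0 = incarnation g (rankOneGL q) 0 0 := by
    simp [Matrix.mulVec, dotProduct]
  rw [h2, incarnation_rank_one g _ q (rankOneGL_apply q)] at h1
  exact Units.ext h1

theorem range_restrict (q : ℂˣ) (hq : 1 < ‖(q : ℂ)‖) (z₀ : ℂˣ)
    :
    (restrict q hq z₀).range = (localSubgroup q).map zalgEquiv.toMonoidHom := by
  ext β
  constructor
  · rintro ⟨α, rfl⟩
    obtain ⟨g, hg⟩ := zalgEquiv.surjective (restrict q hq z₀ α)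
    exact ⟨g, apply_q_eq_one q hq z₀ hg.symm, hg⟩
  · rintro ⟨g, hg, rfl⟩
    exact ⟨autOfLocal q hq z₀ g hg, restrict_autOfLocal q hq z₀ g hg⟩

/-! ### Characters of $\mathbf C^*/q^{\mathbf Z}$ -/

/-- `(χ, λ) ↦ (χ ∘ π, λ)`. -/
def quotientPullback (q : ℂˣ) (x : (ℂˣ ⧸ Subgroup.zpowers q →* ℂˣ) × Multiplicative ℂ) : Zalg :=
  (x.1.comp (QuotientGroup.mk' (Subgroup.zpowers q)), x.2)

theorem quotientPullback_injective (q : ℂˣ) : Function.Injective (quotientPullback q) := by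
  intro x y h
  refine Prod.ext (MonoidHom.ext fun c => ?_) (congrArg (fun g : Zalg => g.2) h)
  obtain ⟨c, rfl⟩ := QuotientGroup.mk_surjective c
  exact DFunLike.congr_fun (congrArg (fun g : Zalg => g.1) h) c

theorem quotientPullback_apply_q (q : ℂˣ)
    (x : (ℂˣ ⧸ Subgroup.zpowers q →* ℂˣ) × Multiplicative ℂ) : (quotientPullback q x).1 q = 1 := by
  show x.1 (q : ℂˣ ⧸ Subgroup.zpowers q) = 1
  rw [(QuotientGroup.eq_one_iff q).mpr (Subgroup.mem_zpowers q), map_one]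

theorem exists_quotientPullback_eq {q : ℂˣ} {g : Zalg} (hg : g.1 q = 1) :
    ∃ x, quotientPullback q x = g := by
  have h : Subgroup.zpowers q ≤ g.1.ker := by
    rw [Subgroup.zpowers_le]
    exact hg
  exact ⟨(QuotientGroup.lift _ g.1 h, g.2), rfl⟩

/-- The homomorphism `Hom(ℂ*/q^ℤ, ℂ*) × ℂ → Aut^⊗(ω_{z₀}⁽⁰⁾)`. -/
def quotientHom (q : ℂˣ) (hq : 1 < ‖(q : ℂ)‖) (z₀ : ℂˣ) :
    ((ℂˣ ⧸ Subgroup.zpowers q →* ℂˣ) × Multiplicative ℂ) →ₙ* AutTensor (omega q hq z₀) where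
  toFun x := autOfLocal q hq z₀ (quotientPullback q x) (quotientPullback_apply_q q x)
  -- Multiplicativity is tested after the injective restriction, where it is that of `zalgEquiv`.
  map_mul' x y := restrict_injective q hq z₀ (by
    rw [map_mul, restrict_autOfLocal, restrict_autOfLocal, restrict_autOfLocal]
    exact map_mul zalgEquiv (quotientPullback q x) (quotientPullback q y))

theorem restrict_quotientHom (q : ℂˣ) (hq : 1 < ‖(q : ℂ)‖) (z₀ : ℂˣ)
    (x : (ℂˣ ⧸ Subgroup.zpowers q →* ℂˣ) × Multiplicative ℂ) :
    restrict q hq z₀ (quotientHom q hq z₀ x) = zalgEquiv (quotientPullback q x) :=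
  restrict_autOfLocal q hq z₀ _ (quotientPullback_apply_q q x)

/-- Surjectivity: the restriction of any $\alpha$ comes from some $(\gamma,\lambda)$ with
$\gamma(q)=1$, and such a $\gamma$ factors through the quotient by $q^{\mathbf Z}$. -/
theorem quotientHom_bijective (q : ℂˣ) (hq : 1 < ‖(q : ℂ)‖) (z₀ : ℂˣ) :
    Function.Bijective (quotientHom q hq z₀) := by
  constructor
  · intro x y h
    refine quotientPullback_injective q (zalgEquiv.injective ?_)
    rw [← restrict_quotientHom q hq z₀, ← restrict_quotientHom q hq z₀, h]
  · intro α
    obtain ⟨g, hg⟩ := zalgEquiv.surjective (restrict q hq z₀ α)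
    obtain ⟨x, rfl⟩ := exists_quotientPullback_eq (apply_q_eq_one q hq z₀ hg.symm)
    exact ⟨x, restrict_injective q hq z₀ ((restrict_quotientHom q hq z₀ x).trans hg)⟩

end QDiff

theorem mainTheorem2 (q : ℂˣ) (hq : 1 < ‖(q : ℂ)‖) (z₀ : ℂˣ) :
    ∃ e : QDiff.Zalg ≃* QDiff.AutTensor QDiff.forgetR,
      (∀ (g : QDiff.Zalg) (X : QDiff.RepZ) (M : Matrix (Fin X.n) (Fin X.n) ℂ),
        QDiff.compMat (e g).1 X = M ↔ QDiff.IsIncarnation g X.A M) ∧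
      Function.Injective (QDiff.restrict q hq z₀) ∧
      (QDiff.restrict q hq z₀).range = (QDiff.localSubgroup q).map e.toMonoidHom ∧
      ∃ e' : ((ℂˣ ⧸ Subgroup.zpowers q →* ℂˣ) × Multiplicative ℂ) ≃*
          QDiff.AutTensor (QDiff.omega q hq z₀),
        ∀ (χ : ℂˣ ⧸ Subgroup.zpowers q →* ℂˣ) (lam : Multiplicative ℂ),
          QDiff.restrict q hq z₀ (e' (χ, lam)) =
            e (χ.comp (QuotientGroup.mk' (Subgroup.zpowers q)), lam) := by
  refine ⟨QDiff.zalgEquiv, fun g X M => ?_, QDiff.restrict_injective q hq z₀,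
    QDiff.range_restrict q hq z₀, MulEquiv.ofBijective _ (QDiff.quotientHom_bijective q hq z₀),
    fun χ lam => QDiff.restrict_quotientHom q hq z₀ (χ, lam)⟩
  have h : QDiff.compMat (QDiff.zalgEquiv g).1 X = QDiff.incarnation g X.A :=
      QDiff.compMat_autOfZalg g X
  rw [h]
  -- The forward direction is the existence of $A^{(\gamma,\lambda)}$, the backward one its
  -- independence of the decomposition.
  exact ⟨fun hM => hM ▸ QDiff.isIncarnation_incarnation g X.A, fun hM => hM.eq⟩

end
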